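/- Let $0<\rho<1$ and $\alpha,h\in\mathbb{R}$. For $k\ge 0$ put $\Delta_k^{\pm}=2k+\tfrac12\pm\sqrt{\tfrac{h}{4(1+\rho^2)}}$ (complex if $h<0$), and for $\xi\in\mathbb{C}$ put $\eta=(1+\rho^2)\xi$ and $z=-\rho^2\xi^2$. Write $(a)_i$ for the Pochhammer symbol and, for $i\le j$, read a quotient $(a)_j/(a)_i$ as $\prod_{i\le l<j}(a+l)$. For $n\ge 0$ let $$ y_n(x)=\sum_{i_0=0}^{\infty}\sum_{i_1=i_0}^{\infty}\cdots\sum_{i_n=i_{n-1}}^{\infty}\ \prod_{k=0}^{n-1}\frac{(i_k+2k+\frac{\alpha}{2}+1)(i_k+2k-\frac{\alpha}{2}+\frac12)}{(i_k+2k+\frac52)(i_k+2k+2)}\ \prod_{k=0}^{n}\frac{(\Delta_k^-)_{i_k}(\Delta_k^+)_{i_k}\,(2k+\frac32)_{i_{k-1}}(2k+1)_{i_{k-1}}}{(\Delta_k^-)_{i_{k-1}}(\Delta_k^+)_{i_{k-1}}\,(2k+\frac32)_{i_k}(2k+1)_{i_k}}\ x^{i_n}\qquad(i_{-1}=0), $$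 and let $$LS^R(\rho,\alpha,h;\xi)=\xi^{1/2}\sum_{n\ge0}y_n(\eta)\,z^n$$ with the principal square root $\xi^{1/2}$. Define $G_0(w)={}_2F_1(\Delta_0^-,\Delta_0^+;\tfrac32;w)$ and, for $m\ge1$ and $0<|w|<1$, $$G_m(w)=\int_0^1 dt\,t^{2m-\frac12}\int_0^1 du\,u^{2m-1}\,\frac1{2\pi i}\oint \frac{dv}{v}\Big(\frac{v-1}{v}\Big)^{-\Delta_m^-}\big(1-w(1-t)(1-u)v\big)^{-\Delta_m^+}\,(D_mG_{m-1})\Big(\frac{v}{v-1}\,\frac{w\,t\,u}{1-w\,v(1-t)(1-u)}\Big),$$ $$D_m=x^{-(2m-1+\frac{\alpha}{2})}\,(x\partial_x)\,x^{\alpha+\frac12}\,(x\partial_x)\,x^{2m-\frac32-\frac{\alpha}{2}}.$$ Here the powers of $v$-dependent quantities are principal. The powers of $x$ in $D_m$ are taken with a common logarithm holomorphic near the point where $D_m$ is evaluated. The contour is any positively oriented circle $|v|=r$ (where $r$ may depend on $m,w,t,u$) with $r>1$ and $r|w|(1-t)(1-u)<1$ on which $\big|\frac{v}{v-1}\frac{wtu}{1-wv(1-t)(1-u)}\big|<1$.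 In other words, $G_n(\eta)$ is the $2n$-fold definite and $n$-fold contour integral, with the factor $m=n$ outermost, of operators acting on ${}_2F_1(\Delta_0^-,\Delta_0^+;\frac32;w_{1,n})$, where $w_{n+1,n}=\eta$ and $$w_{m,n}=\frac{v_m}{v_m-1}\,\frac{w_{m+1,n}t_mu_m}{1-w_{m+1,n}v_m(1-t_m)(1-u_m)}.$$ Then, for every admissible choice of the contours: (1) All derivatives and integrals in the definition of the $G_m$ exist. For $0<|x|<1$ all series in the nested sums $y_n(x)$ converge absolutely, and $y_n(x)=G_n(x)$ for every $n\ge 0$. (2) For every $\xi\ne0$ with $|\eta|+|z|=(1+\rho^2)|\xi|+\rho^2|\xi|^2<1$, the series $\sum_n y_n(\eta)z^n$ and $\sum_n G_n(\eta)z^n$ converge absolutely and $$LS^R(\rho,\alpha,h;\xi)=\xi^{1/2}\Big\{{}_2F_1\big(\Delta_0^-,\Delta_0^+;\tfrac32;\eta\big)+\sum_{n=1}^{\infty}G_n(\eta)\,z^n\Big\}.$$ (3) On the set of $\xi\in\mathbb{C}\setminus(-\infty,0]$ with $(1+\rho^2)|\xi|+\rho^2|\xi|^2<1$, the function $y(\xi)=LS^R(\rho,\alpha,h;\xi)$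 is holomorphic and solves the Lamé equation $$y''+\frac12\Big(\frac1\xi+\frac1{\xi-1}+\frac1{\xi-\rho^{-2}}\Big)y'+\frac{-\alpha(\alpha+1)\xi+h\rho^{-2}}{4\xi(\xi-1)(\xi-\rho^{-2})}\,y=0 .$$ -/

import Mathlib

noncomputable section

namespace Lame

/-- `√(h / (4 (1 + ρ²)))`, a complex number (imaginary for `h < 0`). -/
def sigma (ρ h : ℝ) : ℂ := ((h / (4 * (1 + ρ ^ 2)) : ℝ) : ℂ) ^ (1 / 2 : ℂ)

/-- `Δ_k^- = 2k + 1/2 - √(h / (4 (1 + ρ²)))`. -/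
def deltaMinus (ρ h : ℝ) (k : ℕ) : ℂ := 2 * (k : ℂ) + 1 / 2 - sigma ρ h

/-- `Δ_k^+ = 2k + 1/2 + √(h / (4 (1 + ρ²)))`. -/
def deltaPlus (ρ h : ℝ) (k : ℕ) : ℂ := 2 * (k : ℂ) + 1 / 2 + sigma ρ h

/-- `η = (1 + ρ²) ξ`. -/
def eta (ρ : ℝ) (ξ : ℂ) : ℂ := (1 + (ρ : ℂ) ^ 2) * ξ

/-- `z = -ρ² ξ²`. -/
def zvar (ρ : ℝ) (ξ : ℂ) : ℂ := -(ρ : ℂ) ^ 2 * ξ ^ 2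

/-! ### The Lamé equation -/

/-- The Lamé equation in the variable `ξ = sn²(z, ρ)`, at the point `ξ`. -/
def LameEquationAt (ρ α h : ℝ) (y : ℂ → ℂ) (ξ : ℂ) : Prop :=
  deriv (deriv y) ξ
    + 1 / 2 * (1 / ξ + 1 / (ξ - 1) + 1 / (ξ - ((ρ : ℂ) ^ 2)⁻¹)) * deriv y ξ
    + (-(α : ℂ) * (α + 1) * ξ + h * ((ρ : ℂ) ^ 2)⁻¹)
        / (4 * ξ * (ξ - 1) * (ξ - ((ρ : ℂ) ^ 2)⁻¹)) * y ξ = 0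

/-! ### The power series of the second kind -/

/-- The Pochhammer symbol `(a)_n`. -/
def poch (a : ℂ) (n : ℕ) : ℂ := (ascPochhammer ℂ n).eval a

/-- The quotient `(a)_j / (a)_i` for `i ≤ j`, in cancelled form `∏_{i ≤ l < j} (a + l)`, which also
makes sense when `(a)_i = 0`. -/
def pochQuot (a : ℂ) (i j : ℕ) : ℂ := ∏ l ∈ Finset.Ico i j, (a + (l : ℂ))

theorem pochQuot_eq_div (a : ℂ) (i j : ℕ) (hij : i ≤ j) (ha : poch a i ≠ 0) :
    pochQuot a i j = poch a j / poch a i := by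
  have key : ∀ n, poch a n = ∏ l ∈ Finset.range n, (a + (l : ℂ)) := by
    intro n
    induction n with
    | zero => simp [poch]
    | succ k ih => rw [Finset.prod_range_succ, ← ih, poch, poch, ascPochhammer_succ_eval]
  rw [eq_div_iff ha, key, key, pochQuot, mul_comm]
  exact Finset.prod_range_mul_prod_Ico _ hij

/-- `(Δ_k^-)_j (Δ_k^+)_j (2k+3/2)_i (2k+1)_i / ((Δ_k^-)_i (Δ_k^+)_i (2k+3/2)_j (2k+1)_j)`,
used for `i ≤ j`. -/
def ratio (ρ h : ℝ) (k i j : ℕ) : ℂ :=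
  pochQuot (deltaMinus ρ h k) i j * pochQuot (deltaPlus ρ h k) i j *
    (poch (2 * (k : ℂ) + 3 / 2) i * poch (2 * (k : ℂ) + 1) i) /
    (poch (2 * (k : ℂ) + 3 / 2) j * poch (2 * (k : ℂ) + 1) j)

/-- `(i + 2k + α/2 + 1)(i + 2k - α/2 + 1/2) / ((i + 2k + 5/2)(i + 2k + 2))`. -/
def weight (α : ℝ) (k i : ℕ) : ℂ :=
  ((i : ℂ) + 2 * k + α / 2 + 1) * ((i : ℂ) + 2 * k - α / 2 + 1 / 2) /
    (((i : ℂ) + 2 * k + 5 / 2) * ((i : ℂ) + 2 * k + 2))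

/-- The nested sum over `i ≤ i_k ≤ i_{k+1} ≤ ⋯ ≤ i_{k+r}` (outermost index `i_k`, each series
starting at the preceding index) of
`∏_{l=k}^{k+r-1} weight_l(i_l) ratio_l(i_{l-1}, i_l) · ratio_{k+r}(i_{k+r-1}, i_{k+r}) x^{i_{k+r}}`,
where `i_{k-1} = i`. -/
def nested (ρ α h : ℝ) (x : ℂ) : ℕ → ℕ → ℕ → ℂ
  | 0 => fun k i => ∑' d : ℕ, ratio ρ h k i (i + d) * x ^ (i + d)
  | r + 1 => fun k i => ∑' d : ℕ,
      weight α k (i + d) * ratio ρ h k i (i + d) * nested ρ α h x r (k + 1) (i + d)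

/-- Every single series in `nested` converges (absolutely) at `x`. -/
def NestedSummable (ρ α h : ℝ) (x : ℂ) : Prop :=
  (∀ k i : ℕ, Summable fun d : ℕ => ratio ρ h k i (i + d) * x ^ (i + d)) ∧
  ∀ r k i : ℕ, Summable fun d : ℕ =>
    weight α k (i + d) * ratio ρ h k i (i + d) * nested ρ α h x r (k + 1) (i + d)

/-- The coefficient of `z^n` in the braces of `LS^R`: the nested sum over
`0 ≤ i_0 ≤ i_1 ≤ ⋯ ≤ i_n`. -/
def subSeries (ρ α h : ℝ) (n : ℕ) (x : ℂ) : ℂ := nested ρ α h x n 0 0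

/-- `LS^R(ρ, α, h; ξ, η, z)`, the power series of the second kind about `ξ = 0`, with
`η = (1 + ρ²) ξ` and `z = -ρ² ξ²`. -/
def LS (ρ α h : ℝ) (ξ : ℂ) : ℂ :=
  ξ ^ (1 / 2 : ℂ) * ∑' n : ℕ, subSeries ρ α h n (eta ρ ξ) * zvar ρ ξ ^ n

/-! ### The integral representation -/

/-- The branch of `w ↦ w ^ s` holomorphic near `w₀ ≠ 0` with the principal value at `w₀` (it is
the principal power near `w₀` if `w₀` is not a negative real number). -/
def localPow (w₀ s w : ℂ) : ℂ := Complex.exp (s * (Complex.log w₀ + Complex.log (w / w₀)))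

theorem localPow_eventuallyEq (w₀ s : ℂ) (h : w₀ ∈ Complex.slitPlane) :
    localPow w₀ s =ᶠ[nhds w₀] fun w => w ^ s := by
  have h0 : w₀ ≠ 0 := Complex.slitPlane_ne_zero h
  have c : ContinuousAt (fun w : ℂ => (Complex.log w₀ + Complex.log (w / w₀) - Complex.log w).im) w₀ := by
    have : ContinuousAt (fun w : ℂ => Complex.log (w / w₀)) w₀ :=
      (continuousAt_id.div_const w₀).clog (by simp [h0])
    have h2 : ContinuousAt Complex.log w₀ := continuousAt_clog h
    exact Complex.continuous_im.continuousAt.comp ((continuousAt_const.add this).sub h2)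
  have c0 : (fun w : ℂ => (Complex.log w₀ + Complex.log (w / w₀) - Complex.log w).im) w₀ = 0 := by
    simp [h0]
  have c1 := c.tendsto
  beta_reduce at c0 c1
  rw [c0] at c1
  have hev := c1.eventually (Metric.ball_mem_nhds _ (show (0:ℝ) < 1 by norm_num))
  filter_upwards [hev, isOpen_ne.mem_nhds h0] with w hw hw0
  have hw0 : w ≠ 0 := hw0
  rw [dist_zero_right] at hw
  have : Complex.exp (Complex.log w₀ + Complex.log (w / w₀) - Complex.log w) = 1 := by
    rw [Complex.exp_sub, Complex.exp_add, Complex.exp_log h0, Complex.exp_log (div_ne_zero hw0 h0), Complex.exp_log hw0]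
    field_simp
  obtain ⟨n, hn⟩ := Complex.exp_eq_one_iff.1 this
  have hn0 : n = 0 := by
    rw [hn] at hw
    by_contra hne
    have : (1:ℝ) ≤ |(n:ℝ)| := by exact_mod_cast Int.one_le_abs hne
    simp at hw
    rw [abs_of_pos Real.pi_pos] at hw
    nlinarith [Real.pi_gt_three]
  rw [hn0] at hn
  simp at hn
  rw [localPow, sub_eq_zero.1 hn, Complex.cpow_def_of_ne_zero hw0, mul_comm]

/-- `w ^ (-a) (w ∂_w) w ^ b (w ∂_w) w ^ c` applied to the function `f`, at the point `w₀`. -/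
def eulerOp (a b c : ℂ) (f : ℂ → ℂ) (w₀ : ℂ) : ℂ :=
  localPow w₀ (-a) w₀ * (w₀ * deriv (fun w => localPow w₀ b w *
    (w * deriv (fun w' => localPow w₀ c w' * f w') w)) w₀)

/-- `w_{i,j}` in terms of `w = w_{i+1,j}`: the substitution
`v / (v - 1) · w t u / (1 - w v (1 - t)(1 - u))`. -/
def wNext (w : ℂ) (t u : ℝ) (v : ℂ) : ℂ :=
  v / (v - 1) * (w * t * u / (1 - w * v * (1 - t) * (1 - u)))

/-- The integrand of the `m`-th contour integral, where `w = w_{m+1,n}` and `f` is the function of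
`w_{m,n}` on which the `m`-th differential operator acts. -/
def contourIntegrand (ρ α h : ℝ) (m : ℕ) (f : ℂ → ℂ) (w : ℂ) (t u : ℝ) (v : ℂ) : ℂ :=
  1 / v * ((v - 1) / v) ^ (-deltaMinus ρ h m) *
    (1 - w * (1 - t) * (1 - u) * v) ^ (-deltaPlus ρ h m) *
    eulerOp (2 * m - 1 + α / 2) (α + 1 / 2) (2 * m - 3 / 2 - α / 2) f (wNext w t u v)

/-- `u^{2m-1} (1 / 2πi) ∮ ⋯ dv`; the contour is the positively oriented circle `|v| = r`. -/
def uIntegrand (ρ α h : ℝ) (m : ℕ) (f : ℂ → ℂ) (r : ℝ) (w : ℂ) (t u : ℝ) : ℂ :=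
  ((u ^ (2 * (m : ℝ) - 1) : ℝ) : ℂ) *
    ((2 * Real.pi * Complex.I)⁻¹ * ∮ v in C(0, r), contourIntegrand ρ α h m f w t u v)

/-- `t^{2m-1/2} ∫_0^1 du u^{2m-1} (1 / 2πi) ∮ ⋯ dv`, where `r u` is the radius of the contour. -/
def tIntegrand (ρ α h : ℝ) (m : ℕ) (f : ℂ → ℂ) (r : ℝ → ℝ) (w : ℂ) (t : ℝ) : ℂ :=
  ((t ^ (2 * (m : ℝ) - 1 / 2) : ℝ) : ℂ) *
    ∫ u in (0 : ℝ)..1, uIntegrand ρ α h m f (r u) w t u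

/-- The coefficient of `z^n` in the integral representation, as a function of `w_{n+1,n}`
(which is `η` in the end): the `2n`-fold definite and `n`-fold contour integral, the factor with
index `n` being outermost, applied to `₂F₁(Δ_0^-, Δ_0^+; 3/2; w_{1,n})`. The contour of the `m`-th
contour integral is the circle about `0` of radius `R m w_{m+1,n} t_m u_m`. -/
def subIntegral (ρ α h : ℝ) (R : ℕ → ℂ → ℝ → ℝ → ℝ) : ℕ → ℂ → ℂ
  | 0 => fun w => ordinaryHypergeometric (deltaMinus ρ h 0) (deltaPlus ρ h 0) (3 / 2 : ℂ) w
  | m + 1 => fun w => ∫ t in (0 : ℝ)..1,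
      tIntegrand ρ α h (m + 1) (subIntegral ρ α h R m) (R (m + 1) w t) w t

/-- The radii `R` are admissible: the `m`-th contour encircles the singularities `0` and `1` of the
integrand but not `1 / (w_{m+1,n} (1 - t)(1 - u))`, and on it `w_{m,n}` stays inside the unit disc,
where `₂F₁` is given by its series. -/
def AdmissibleRadii (R : ℕ → ℂ → ℝ → ℝ → ℝ) : Prop :=
  ∀ (m : ℕ) (w : ℂ) (t u : ℝ), 1 ≤ m → w ≠ 0 → ‖w‖ < 1 → t ∈ Set.Ioo (0 : ℝ) 1 →
    u ∈ Set.Ioo (0 : ℝ) 1 →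
    1 < R m w t u ∧ ‖w‖ * (1 - t) * (1 - u) * R m w t u < 1 ∧
      ∀ v : ℂ, ‖v‖ = R m w t u → ‖wNext w t u v‖ < 1

theorem exists_admissibleRadii : ∃ R, AdmissibleRadii R := by
  refine ⟨fun _ w t u => 1 / √(‖w‖ * (1 - t) * (1 - u)), ?_⟩
  rintro m w t u - hw0 hw ⟨ht0, ht1⟩ ⟨hu0, hu1⟩
  have hwp : 0 < ‖w‖ := norm_pos_iff.2 hw0
  set X := ‖w‖ * (1 - t) * (1 - u) with hX
  have h1t : 0 < 1 - t := by linarith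
  have h1u : 0 < 1 - u := by linarith
  have hXp : 0 < X := by positivity
  have hX1 : X < 1 := by
    have : ‖w‖ * (1 - t) < 1 := by nlinarith
    nlinarith
  set s := √X with hs
  have hsp : 0 < s := Real.sqrt_pos.2 hXp
  have hss : s * s = X := Real.mul_self_sqrt hXp.le
  have hs1 : s < 1 := by nlinarith
  refine ⟨by rw [lt_div_iff₀ hsp]; linarith, ?_, ?_⟩
  · show X * (1 / s) < 1
    rw [← hss]; field_simp; exact hs1
  intro v hv
  change ‖v‖ = 1 / s at hv
  have hb1 : ‖v‖ - 1 ≤ ‖v - 1‖ := by simpa using norm_sub_norm_le v 1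
  have hnv : ‖w * v * (1 - t) * (1 - u)‖ = s := by
    have e1 : ‖(1 - t : ℂ)‖ = 1 - t := by
      rw [show (1 - t : ℂ) = ((1 - t : ℝ) : ℂ) by push_cast; rfl, Complex.norm_real, Real.norm_of_nonneg h1t.le]
    have e2 : ‖(1 - u : ℂ)‖ = 1 - u := by
      rw [show (1 - u : ℂ) = ((1 - u : ℝ) : ℂ) by push_cast; rfl, Complex.norm_real, Real.norm_of_nonneg h1u.le]
    rw [norm_mul, norm_mul, norm_mul, e1, e2, hv]
    have : ‖w‖ * (1 / s) * (1 - t) * (1 - u) = X / s := by rw [hX]; ring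
    rw [this, ← hss]; field_simp
  have hb2 : 1 - s ≤ ‖1 - w * v * (1 - t) * (1 - u)‖ := by
    have := norm_sub_norm_le (1 : ℂ) (w * v * (1 - t) * (1 - u))
    rw [hnv] at this; simpa using this
  have hd : 0 < 1 - s := by linarith
  have hv1 : 0 < ‖v‖ - 1 := by
    rw [hv]; have : 1 < 1 / s := by rw [lt_div_iff₀ hsp]; linarith
    linarith
  have et : ‖(t:ℂ)‖ = t := by rw [Complex.norm_real, Real.norm_of_nonneg ht0.le]
  have eu : ‖(u:ℂ)‖ = u := by rw [Complex.norm_real, Real.norm_of_nonneg hu0.le]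
  rw [wNext, norm_mul, norm_div, norm_div, norm_mul, norm_mul, et, eu]
  have key : ‖w‖ * t * u < (1 - s) ^ 2 := by
    have h2 : s ≤ 1 - (t + u) / 2 := by
      have : X ≤ (1 - (t+u)/2)^2 := by nlinarith [sq_nonneg (t - u), mul_pos h1t h1u]
      exact Real.sqrt_le_iff.2 ⟨by linarith, this⟩
    have h3 : t * u ≤ ((t+u)/2)^2 := by nlinarith [sq_nonneg (t - u)]
    have h4 : 0 < t * u := by positivity
    nlinarith
  have hA : ‖v‖ / ‖v - 1‖ ≤ ‖v‖ / (‖v‖ - 1) := by gcongr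
  have hB : ‖w‖ * t * u / ‖1 - w * v * (1 - t) * (1 - u)‖ ≤ ‖w‖ * t * u / (1 - s) := by gcongr
  calc _ ≤ ‖v‖ / (‖v‖ - 1) * (‖w‖ * t * u / (1 - s)) := by gcongr
    _ = ‖w‖ * t * u / (1 - s) ^ 2 := by
      rw [hv]
      have : 1 - s ≠ 0 := hd.ne'
      have : 1 / s - 1 ≠ 0 := by rw [← hv]; exact hv1.ne'
      field_simp
    _ < 1 := by rw [div_lt_one (by positivity)]; exact key

/-- All integrals and derivatives in `subIntegral` with outer variable in the punctured unit disc
exist. -/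
def IntegralsExist (ρ α h : ℝ) (R : ℕ → ℂ → ℝ → ℝ → ℝ) : Prop :=
  ∀ m : ℕ, DifferentiableOn ℂ (subIntegral ρ α h R m) (Metric.ball 0 1 \ {0}) ∧
    ∀ w : ℂ, w ≠ 0 → ‖w‖ < 1 →
      (∀ t ∈ Set.Ioo (0 : ℝ) 1, ∀ u ∈ Set.Ioo (0 : ℝ) 1,
        CircleIntegrable (contourIntegrand ρ α h (m + 1) (subIntegral ρ α h R m) w t u) 0
          (R (m + 1) w t u)) ∧
      (∀ t ∈ Set.Ioo (0 : ℝ) 1, IntervalIntegrable (fun u =>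
        uIntegrand ρ α h (m + 1) (subIntegral ρ α h R m) (R (m + 1) w t u) w t u)
          MeasureTheory.volume 0 1) ∧
      IntervalIntegrable (fun t =>
        tIntegrand ρ α h (m + 1) (subIntegral ρ α h R m) (R (m + 1) w t) w t)
          MeasureTheory.volume 0 1

end Lame

end

/-! Everything rests on one observation: the quotients of Pochhammer symbols and the weights depend
on the index `i` and the level `k` only through the total degree `i + 2k`. Hence the nested sum is a
power series in `x` whose coefficients count weighted lattice paths: a unit step out of degree `a`
has weight `stepRatio a`, a double step has weight `weight α 0 a`, and the coefficient of `x ^ m z ^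
n` sums over paths from 0 with `m` unit and `n` double steps.

Convergence. Both weights are eventually at most 1 in modulus and a path leaves each degree at most
once, so every path has uniformly bounded weight; there are `(n + m).choose m` paths
(`exists_norm_pathSum_le`). By the binomial theorem the double series converges absolutely for `|x|
+ |z| < 1`.

Lamé equation. Splitting a path at its last step gives a recurrence (`pathSum_succ_succ`). With `N =
m + 2n`, the denominators of both weights become the same polynomial `N (N + 1/2)`, and clearing
them gives Frobenius' three-term relation, which sums to a differential equation for the holomorphic
factor (`lameSeries_ode`); the factor `ξ ^ (1/2)` turns it into Lamé's equation.

Integrals. Splitting instead at the last double step (`pathSum_succ_eq_sum_antidiagonal`) matches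
the passage from `G_{m-1}` to `G_m`. On `x ^ j` the operator `D_m` yields the numerator of the
weight, the contour integral yields the coefficients `(Δ⁻+j)_d (Δ⁺+j)_d / d!²`, and the two Beta
integrals supply `d!²` and all denominators (`stepTerm_mul_betaCoeff`). Interchanging sums and
integrals needs a majorant uniform in `t` and `u` (`exists_bound_contour_terms`). The value does not
depend on the contours, and `G_n = y_n` follows by induction (`subIntegral_eq`). -/

namespace Lame

/-! ### Weighted lattice paths with steps of length one and two -/

section LatticePaths

/-- The weighted sum over lattice paths from `a` with `m` unit steps (a step leaving `c` has weight
`f c`) and `r` steps of length two (with weight `g c`). -/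
noncomputable def pathSum (f g : ℕ → ℂ) : ℕ → ℕ → ℕ → ℂ
  | 0 => fun a m => ∏ l ∈ Finset.range m, f (a + l)
  | r + 1 => fun a m => ∑ p ∈ Finset.HasAntidiagonal.antidiagonal m,
      (∏ l ∈ Finset.range p.1, f (a + l)) * g (a + p.1) * pathSum f g r (a + p.1 + 2) p.2

variable (f g : ℕ → ℂ)

theorem pathSum_zero_succ (a m : ℕ) :
    pathSum f g 0 a (m + 1) = f (a + m) * pathSum f g 0 a m := by
  simp only [pathSum, Finset.prod_range_succ]; ring

theorem pathSum_succ_zero (r a : ℕ) :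
    pathSum f g (r + 1) a 0 = g (a + 2 * r) * pathSum f g r a 0 := by
  induction r generalizing a with
  | zero => simp [pathSum]
  | succ r ih =>
    have h : ∀ r, pathSum f g (r + 1) a 0 = g a * pathSum f g r (a + 2) 0 := by
      intro r; simp [pathSum]
    rw [h, ih, h r, show a + 2 + 2 * r = a + 2 * (r + 1) by ring]
    ring

/-- Classification by the last step: the end point is `a + 2r + m + 3`, reached from one or two
below. The definition classifies by the first double step instead. -/
theorem pathSum_succ_succ (r a m : ℕ) :
    pathSum f g (r + 1) a (m + 1) = f (a + 2 * r + m + 2) * pathSum f g (r + 1) a m +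
      g (a + 2 * r + m + 1) * pathSum f g r a (m + 1) := by
  induction r generalizing a m with
  | zero =>
    simp only [pathSum, Finset.Nat.antidiagonal_succ', Finset.sum_cons, Finset.mul_sum,
      Finset.sum_map, Function.Embedding.prodMap, Function.Embedding.coeFn_mk, Prod.map,
      Function.Embedding.refl_apply, Finset.prod_range_zero, mul_one]
    rw [add_comm]
    congr 1
    · refine Finset.sum_congr rfl fun p hp => ?_
      have := Finset.HasAntidiagonal.mem_antidiagonal.1 hp
      rw [Finset.prod_range_succ, show a + p.1 + 2 + p.2 = a + 2 * 0 + m + 2 by omega]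
      ring
    · rw [show a + (m + 1) = a + 2 * 0 + m + 1 by ring]; ring
  | succ r ih =>
    have h : ∀ r m, pathSum f g (r + 1) a m = ∑ p ∈ Finset.HasAntidiagonal.antidiagonal m,
      (∏ l ∈ Finset.range p.1, f (a + l)) * g (a + p.1) * pathSum f g r (a + p.1 + 2) p.2 :=
      fun _ _ => rfl
    rw [h (r + 1), h (r + 1), h r]
    simp only [Finset.Nat.antidiagonal_succ', Finset.sum_cons, Finset.mul_sum, mul_add,
      Finset.sum_map, Function.Embedding.prodMap, Function.Embedding.coeFn_mk, Prod.map,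
      Function.Embedding.refl_apply, pathSum_succ_zero, mul_one]
    conv_rhs => rw [add_left_comm, ← Finset.sum_add_distrib]
    congr 1
    · rw [show a + (m + 1) + 2 + 2 * r = a + 2 * (r + 1) + m + 1 by ring]; ring_nf
    · refine Finset.sum_congr rfl fun p hp => ?_
      have := Finset.HasAntidiagonal.mem_antidiagonal.1 hp
      rw [Nat.succ_eq_add_one, ih, show a + p.1 + 2 + 2 * r + p.2 + 2 = a + 2 * (r + 1) + m + 2 by omega,
        show a + p.1 + 2 + 2 * r + p.2 + 1 = a + 2 * (r + 1) + m + 1 by omega]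
      ring_nf

/-- Classification by the last double step. The nested sums peel off double steps from the start of
the path, the integral recursion from its end; this identity reconciles the two orders. -/
theorem pathSum_succ_eq_sum_antidiagonal (r a m : ℕ) :
    pathSum f g (r + 1) a m = ∑ p ∈ Finset.HasAntidiagonal.antidiagonal m, pathSum f g r a p.1 *
      g (a + 2 * r + p.1) * ∏ l ∈ Finset.range p.2, f (a + 2 * r + p.1 + 2 + l) := by
  induction m with
  | zero => simp [pathSum_succ_zero, mul_comm]
  | succ m ih =>
    rw [pathSum_succ_succ, ih, Finset.Nat.antidiagonal_succ', Finset.sum_cons, Finset.sum_map,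
      Finset.mul_sum, add_comm]
    congr 1
    · simp only [Finset.prod_range_zero]
      rw [show a + 2 * r + m + 1 = a + 2 * r + (m + 1) by ring]; ring
    · refine Finset.sum_congr rfl fun p hp => ?_
      have := Finset.HasAntidiagonal.mem_antidiagonal.1 hp
      simp only [Function.Embedding.prodMap, Function.Embedding.coeFn_mk, Prod.map,
        Function.Embedding.refl_apply, Finset.prod_range_succ, Nat.succ_eq_add_one]
      rw [show a + 2 * r + p.1 + 2 + p.2 = a + 2 * r + m + 2 by omega]
      ring

variable {f g}

theorem exists_prod_max_le (hf : ∃ N, ∀ a ≥ N, ‖f a‖ ≤ 1) (hg : ∃ N, ∀ a ≥ N, ‖g a‖ ≤ 1) :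
    ∃ M : ℝ, ∀ n, ∏ l ∈ Finset.range n, max 1 (max ‖f l‖ ‖g l‖) ≤ M := by
  obtain ⟨N, hN⟩ := hf
  obtain ⟨K, hK⟩ := hg
  refine ⟨∏ l ∈ Finset.range (N + K), max 1 (max ‖f l‖ ‖g l‖), fun n => ?_⟩
  rcases le_total n (N + K) with h | h
  · exact Finset.prod_le_prod_of_subset_of_one_le (by simpa using h)
      (fun _ _ => by positivity) (fun _ _ _ => le_max_left _ _)
  · rw [← Finset.prod_range_mul_prod_Ico _ h, Finset.prod_eq_one (s := Finset.Ico _ _), mul_one]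
    intro l hl
    have := (Finset.mem_Ico.1 hl).1
    exact max_eq_left (max_le (hN l (by omega)) (hK l (by omega)))

/-- The degrees left along a path are distinct, so its weight is at most the product of `max 1 (max
‖f l‖ ‖g l‖)` over all degrees below its end; the binomial coefficient is the number of paths.
Pascal's rule accompanies the recurrence by the last step. -/
theorem norm_pathSum_le_prod (r a m : ℕ) : ‖pathSum f g r a m‖ ≤
    (∏ l ∈ Finset.range (a + 2 * r + m), max 1 (max ‖f l‖ ‖g l‖)) * ((r + m).choose m : ℕ) := by
  set P : ℕ → ℝ := fun n => ∏ l ∈ Finset.range n, max 1 (max ‖f l‖ ‖g l‖) with hP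
  have h1 : ∀ n, 1 ≤ P n := fun n => Finset.one_le_prod fun _ _ => le_max_left _ _
  have hs : ∀ n, P (n + 1) = P n * max 1 (max ‖f n‖ ‖g n‖) :=
    fun n => Finset.prod_range_succ _ _
  have hm : ∀ n, P n ≤ P (n + 1) := fun n => by
    rw [hs]; exact le_mul_of_one_le_right (by linarith [h1 n]) (le_max_left _ _)
  have hfP : ∀ n, ‖f n‖ * P n ≤ P (n + 1) := fun n => by
    rw [hs, mul_comm]
    exact mul_le_mul_of_nonneg_left (le_max_of_le_right (le_max_left _ _)) (by linarith [h1 n])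
  have hgP : ∀ n, ‖g n‖ * P n ≤ P (n + 1) := fun n => by
    rw [hs, mul_comm]
    exact mul_le_mul_of_nonneg_left (le_max_of_le_right (le_max_right _ _)) (by linarith [h1 n])
  change _ ≤ P _ * _
  induction r generalizing m with
  | zero =>
    simp only [Nat.zero_add, Nat.choose_self, Nat.cast_one, mul_one, Nat.mul_zero, Nat.add_zero]
    induction m with
    | zero => simpa [pathSum] using h1 a
    | succ m ih =>
      rw [pathSum_zero_succ, norm_mul]
      exact (mul_le_mul_of_nonneg_left ih (norm_nonneg _)).trans (hfP _)
  | succ r ihr =>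
    induction m with
    | zero =>
      rw [pathSum_succ_zero, norm_mul]
      have := ihr 0
      simp only [Nat.add_zero, Nat.choose_zero_right, Nat.cast_one, mul_one] at this ⊢
      calc _ ≤ ‖g (a + 2 * r)‖ * P (a + 2 * r) := by gcongr
        _ ≤ _ := (hgP _).trans (hm _)
    | succ m ih =>
      rw [pathSum_succ_succ]
      have hf' := hfP (a + 2 * r + m + 2)
      have hg' := (hgP (a + 2 * r + m + 1)).trans (hm _)
      have ih' := ihr (m + 1)
      have e : ((r + 1 + (m + 1)).choose (m + 1) : ℕ) =
          (r + 1 + m).choose m + (r + (m + 1)).choose (m + 1) := by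
        rw [show r + 1 + (m + 1) = (r + 1 + m) + 1 by ring, Nat.choose_succ_succ,
          show r + 1 + m = r + (m + 1) by ring]
      rw [show a + 2 * (r + 1) + (m + 1) = a + 2 * r + m + 1 + 1 + 1 by ring, e, Nat.cast_add,
        mul_add]
      rw [show a + 2 * (r + 1) + m = a + 2 * r + m + 2 by ring] at ih
      rw [show a + 2 * r + (m + 1) = a + 2 * r + m + 1 by ring] at ih'
      refine (norm_add_le _ _).trans (add_le_add ?_ ?_)
      · rw [norm_mul]
        calc _ ≤ ‖f (a + 2 * r + m + 2)‖ * (P (a + 2 * r + m + 2) * _) := by gcongr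
          _ ≤ _ := by rw [← mul_assoc]; gcongr
      · rw [norm_mul]
        calc _ ≤ ‖g (a + 2 * r + m + 1)‖ * (P (a + 2 * r + m + 1) * _) := by gcongr
          _ ≤ _ := by rw [← mul_assoc]; gcongr

theorem exists_norm_pathSum_le (hf : ∃ N, ∀ a ≥ N, ‖f a‖ ≤ 1) (hg : ∃ N, ∀ a ≥ N, ‖g a‖ ≤ 1) :
    ∃ M : ℝ, 0 ≤ M ∧ ∀ r a m, ‖pathSum f g r a m‖ ≤ M * ((r + m).choose m : ℕ) := by
  obtain ⟨M, hM⟩ := exists_prod_max_le hf hg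
  exact ⟨M, by simpa using zero_le_one.trans (hM 0),
    fun r a m => (norm_pathSum_le_prod r a m).trans (by gcongr; exact hM _)⟩

end LatticePaths

/-! ### The nested sums as power series -/

section NestedSums

section PathSeries

variable {f g : ℕ → ℂ} {M : ℝ}

theorem summable_choose_mul_pow (r : ℕ) {q : ℝ} (h0 : 0 ≤ q) (h1 : q < 1) :
    Summable fun m : ℕ => ((r + m).choose m : ℝ) * q ^ m := by
  have := summable_choose_mul_geometric_of_norm_lt_one r
    (show ‖q‖ < 1 by rwa [Real.norm_of_nonneg h0])
  refine this.congr fun m => ?_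
  rw [add_comm, Nat.choose_symm_add]

theorem summable_pathSum_mul_pow (hM : ∀ r a m, ‖pathSum f g r a m‖ ≤ M * ((r + m).choose m : ℕ))
    (r a : ℕ) {x : ℂ} (hx : ‖x‖ < 1) : Summable fun m => pathSum f g r a m * x ^ m := by
  refine .of_norm_bounded ((summable_choose_mul_pow r (norm_nonneg x) hx).mul_left M) fun m => ?_
  rw [norm_mul, norm_pow, ← mul_assoc]
  exact mul_le_mul_of_nonneg_right (hM r a m) (by positivity)

/-- One absolutely convergent double series summed in two ways. By rows, `d` is the number of unit
steps before the first double step; along antidiagonals the definition of `pathSum` appears. -/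
theorem hasSum_pathSum_succ (hM : ∀ r a m, ‖pathSum f g r a m‖ ≤ M * ((r + m).choose m : ℕ))
    (r a : ℕ) {x : ℂ} (hx : ‖x‖ < 1) :
    HasSum (fun d => g (a + d) * (∏ l ∈ Finset.range d, f (a + l)) *
        (x ^ d * ∑' m, pathSum f g r (a + d + 2) m * x ^ m))
      (∑' m, pathSum f g (r + 1) a m * x ^ m) := by
  have hf : ∀ d, ‖∏ l ∈ Finset.range d, f (a + l)‖ ≤ M := fun d => by
    simpa [pathSum] using hM 0 a d
  have hg : ∀ a, ‖g a‖ ≤ M := fun a => by simpa [pathSum] using hM 1 a 0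
  have hM0 : 0 ≤ M := (norm_nonneg _).trans (hg 0)
  set F : ℕ × ℕ → ℂ := fun p => g (a + p.1) * (∏ l ∈ Finset.range p.1, f (a + l)) *
    (x ^ p.1 * (pathSum f g r (a + p.1 + 2) p.2 * x ^ p.2)) with hF
  have hS : Summable F := by
    have := (((summable_geometric_of_lt_one (norm_nonneg x) hx).mul_of_nonneg
      (summable_choose_mul_pow r (norm_nonneg x) hx) (fun _ => by positivity)
      (fun _ => by positivity)).mul_left (M * M * M))
    refine .of_norm_bounded this fun p => ?_
    simp only [hF, norm_mul, norm_pow]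
    calc _ ≤ M * M * (‖x‖ ^ p.1 * (M * ((r + p.2).choose p.2 : ℕ) * ‖x‖ ^ p.2)) := by
          gcongr
          · exact hg _
          · exact hf _
          · exact hM _ _ _
      _ = _ := by ring
  have h1 := hS.hasSum.prod_fiberwise (fun d =>
    ((summable_pathSum_mul_pow hM r (a + d + 2) hx).hasSum.mul_left (x ^ d)).mul_left
      (g (a + d) * (∏ l ∈ Finset.range d, f (a + l))))
  have h2 : HasSum (fun m => pathSum f g (r + 1) a m * x ^ m) (∑' p, F p) := by
    have := (Finset.HasAntidiagonal.sigmaAntidiagonalEquivProd (A := ℕ)).hasSum_iff.2 hS.hasSum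
    refine this.sigma fun m => ?_
    convert hasSum_fintype _ using 1
    rw [pathSum, Finset.sum_mul, ← Finset.sum_coe_sort]
    refine Finset.sum_congr rfl fun p _ => ?_
    have hp := Finset.HasAntidiagonal.mem_antidiagonal.1 p.2
    simp only [hF, Function.comp, Finset.HasAntidiagonal.sigmaAntidiagonalEquivProd_apply]
    rw [show x ^ m = x ^ (p.1.1 + p.1.2) by rw [hp], pow_add]
    ring
  rwa [h2.tsum_eq]

end PathSeries

variable (ρ α h : ℝ)

/-- The ratio of successive coefficients of the hypergeometric series, as a function of the total
degree. -/
noncomputable def stepRatio (a : ℕ) : ℂ :=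
  (((a : ℂ) + 1 / 2) ^ 2 - sigma ρ h ^ 2) / (((a : ℂ) + 1) * (a + 3 / 2))

theorem poch_succ (a : ℂ) (n : ℕ) : poch a (n + 1) = poch a n * (a + n) := by
  rw [poch, poch, ascPochhammer_succ_eval]

theorem pochQuot_succ (a : ℂ) (i d : ℕ) :
    pochQuot a i (i + (d + 1)) = pochQuot a i (i + d) * (a + (i + d : ℕ)) := by
  rw [pochQuot, pochQuot, ← add_assoc, Finset.prod_Ico_succ_top (by omega)]

theorem poch_ne_zero {a : ℝ} (ha : 0 < a) (n : ℕ) : poch a n ≠ 0 := by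
  induction n with
  | zero => simp [poch]
  | succ n ih =>
    rw [poch_succ]
    refine mul_ne_zero ih ?_
    exact_mod_cast (by positivity : a + n ≠ 0)

/-- The factors `(Δ⁻ + i + l)(Δ⁺ + i + l) = (2k + i + l + 1/2)² - σ²` and both denominators involve
only the total degree. -/
theorem ratio_eq_prod (k i d : ℕ) :
    ratio ρ h k i (i + d) = ∏ l ∈ Finset.range d, stepRatio ρ h (i + 2 * k + l) := by
  have p1 : ∀ n, poch (2 * (k : ℂ) + 3 / 2) n ≠ 0 := fun n => by
    simpa using poch_ne_zero (a := 2 * k + 3 / 2) (by positivity) n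
  have p2 : ∀ n, poch (2 * (k : ℂ) + 1) n ≠ 0 := fun n => by
    simpa using poch_ne_zero (a := 2 * k + 1) (by positivity) n
  induction d with
  | zero =>
    simp only [ratio, pochQuot, add_zero, Finset.Ico_self, Finset.prod_empty, Finset.range_zero,
      one_mul]
    exact div_self (mul_ne_zero (p1 i) (p2 i))
  | succ d ih =>
    rw [Finset.prod_range_succ, ← ih, ratio, ratio, pochQuot_succ, pochQuot_succ, ← add_assoc,
      poch_succ, poch_succ, stepRatio]
    have n1 := p1 (i + d)
    have n2 := p2 (i + d)
    have n3 : (2 * (k : ℂ) + 3 / 2) + (i + d : ℕ) ≠ 0 := by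
      have := Complex.ofReal_ne_zero.2 (by positivity : (2 * (k : ℝ) + 3 / 2) + (i + d : ℕ) ≠ 0)
      simpa using this
    have n4 : (2 * (k : ℂ) + 1) + (i + d : ℕ) ≠ 0 := by
      have := Complex.ofReal_ne_zero.2 (by positivity : (2 * (k : ℝ) + 1) + (i + d : ℕ) ≠ 0)
      simpa using this
    have e3 : ((i + 2 * k + d : ℕ) : ℂ) + 3 / 2 = (2 * (k : ℂ) + 3 / 2) + (i + d : ℕ) := by
      push_cast; ring
    have e4 : ((i + 2 * k + d : ℕ) : ℂ) + 1 = (2 * (k : ℂ) + 1) + (i + d : ℕ) := by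
      push_cast; ring
    rw [e3, e4, div_mul_div_comm, div_eq_div_iff (mul_ne_zero (mul_ne_zero n1 n3) (mul_ne_zero n2 n4))
      (mul_ne_zero (mul_ne_zero n1 n2) (mul_ne_zero n4 n3))]
    simp only [deltaMinus, deltaPlus]
    push_cast
    ring

theorem weight_eq (k i : ℕ) : weight α k i = weight α 0 (i + 2 * k) := by
  simp only [weight]
  push_cast
  simp

theorem sigma_sq : sigma ρ h ^ 2 = ((h / (4 * (1 + ρ ^ 2)) : ℝ) : ℂ) := by
  rw [sigma, show (1 / 2 : ℂ) = ((2 : ℕ) : ℂ)⁻¹ by norm_num]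
  exact Complex.cpow_nat_inv_pow _ (by norm_num)

theorem norm_stepRatio_le_one : ∃ N, ∀ a ≥ N, ‖stepRatio ρ h a‖ ≤ 1 := by
  set s := h / (4 * (1 + ρ ^ 2)) with hs
  -- The denominator exceeds `(a + 1/2)²` by `3a/2 + 5/4`, which absorbs `s` once `a ≥ |s|`.
  refine ⟨⌈|s|⌉₊, fun a ha => ?_⟩
  have ha' : |s| ≤ a := Nat.ceil_le.1 ha
  have e : stepRatio ρ h a = ((((a : ℝ) + 1 / 2) ^ 2 - s) / ((a + 1) * (a + 3 / 2)) : ℝ) := by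
    rw [stepRatio, sigma_sq, ← hs]; push_cast; rfl
  rw [e, Complex.norm_real, Real.norm_eq_abs, abs_div,
    abs_of_pos (show 0 < ((a : ℝ) + 1) * (a + 3 / 2) by positivity), div_le_one (by positivity),
    abs_le]
  have := abs_le.1 ha'
  constructor <;> nlinarith

theorem norm_weight_le_one : ∃ N, ∀ a ≥ N, ‖weight α 0 a‖ ≤ 1 := by
  -- The numerator is `a² + 3a/2 + 1/2 - (α/4 + α²/4)`, the denominator `a² + 9a/2 + 5`.
  refine ⟨⌈|α / 4 + α ^ 2 / 4|⌉₊, fun a ha => ?_⟩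
  have ha' : |α / 4 + α ^ 2 / 4| ≤ (a : ℝ) := Nat.ceil_le.1 ha
  have e : weight α 0 a = (((a : ℝ) + α / 2 + 1) * (a - α / 2 + 1 / 2) /
      ((a + 5 / 2) * (a + 2)) : ℝ) := by
    rw [weight]; push_cast; simp
  rw [e, Complex.norm_real, Real.norm_eq_abs, abs_div,
    abs_of_pos (show 0 < ((a : ℝ) + 5 / 2) * (a + 2) by positivity), div_le_one (by positivity),
    abs_le]
  have := abs_le.1 ha'
  constructor <;> nlinarith

/-- The coefficient of `x ^ m` in the `r`-fold nested sum starting at total degree `a`. -/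
noncomputable abbrev lameCoeff : ℕ → ℕ → ℕ → ℂ := pathSum (stepRatio ρ h) (weight α 0)

theorem exists_norm_lameCoeff_le :
    ∃ M : ℝ, 0 ≤ M ∧ ∀ r a m, ‖lameCoeff ρ α h r a m‖ ≤ M * ((r + m).choose m : ℕ) :=
  exists_norm_pathSum_le (norm_stepRatio_le_one ρ h) (norm_weight_le_one α)

variable {x : ℂ}

theorem summable_lameCoeff (hx : ‖x‖ < 1) (r a : ℕ) :
    Summable fun m => lameCoeff ρ α h r a m * x ^ m := by
  obtain ⟨M, -, hM⟩ := exists_norm_lameCoeff_le ρ α h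
  exact summable_pathSum_mul_pow hM r a hx

theorem hasSum_nested_zero (hx : ‖x‖ < 1) (k i : ℕ) :
    HasSum (fun d : ℕ => ratio ρ h k i (i + d) * x ^ (i + d))
      (x ^ i * ∑' m, lameCoeff ρ α h 0 (i + 2 * k) m * x ^ m) := by
  refine ((summable_lameCoeff ρ α h hx 0 (i + 2 * k)).hasSum.mul_left (x ^ i)).congr_fun ?_
  intro d
  rw [ratio_eq_prod, pow_add, lameCoeff, pathSum]; ring

theorem nested_eq (hx : ‖x‖ < 1) (r k i : ℕ) :
    nested ρ α h x r k i = x ^ i * ∑' m, lameCoeff ρ α h r (i + 2 * k) m * x ^ m := by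
  induction r generalizing k i with
  | zero => exact (hasSum_nested_zero ρ α h hx k i).tsum_eq
  | succ r ih =>
    obtain ⟨M, -, hM⟩ := exists_norm_lameCoeff_le ρ α h
    rw [nested, ← ((hasSum_pathSum_succ hM r (i + 2 * k) hx).mul_left (x ^ i)).tsum_eq]
    refine tsum_congr fun d => ?_
    rw [ih, ratio_eq_prod, weight_eq, pow_add,
      show i + d + 2 * (k + 1) = i + 2 * k + d + 2 by ring,
      show i + d + 2 * k = i + 2 * k + d by ring]
    ring

theorem nestedSummable (hx : ‖x‖ < 1) : NestedSummable ρ α h x := by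
  refine ⟨fun k i => (hasSum_nested_zero ρ α h hx k i).summable, fun r k i => ?_⟩
  obtain ⟨M, -, hM⟩ := exists_norm_lameCoeff_le ρ α h
  refine ((hasSum_pathSum_succ hM r (i + 2 * k) hx).mul_left (x ^ i)).summable.congr fun d => ?_
  rw [nested_eq ρ α h hx, ratio_eq_prod, weight_eq α k, pow_add,
    show i + d + 2 * (k + 1) = i + 2 * k + d + 2 by ring,
    show i + d + 2 * k = i + 2 * k + d by ring]
  ring

theorem subSeries_eq (hx : ‖x‖ < 1) (n : ℕ) :
    subSeries ρ α h n x = ∑' m, lameCoeff ρ α h n 0 m * x ^ m := by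
  rw [subSeries, nested_eq ρ α h hx]; simp

end NestedSums

/-! ### Convergence of the double series and the Lamé equation -/

section LameEquation

/-- By the binomial theorem the `n`-th antidiagonal sums to `(p + q) ^ n`. -/
theorem summable_choose_mul_pow_mul_pow {p q : ℝ} (hp : 0 ≤ p) (hq : 0 ≤ q) (h : p + q < 1) :
    Summable fun i : ℕ × ℕ => ((i.1 + i.2).choose i.2 : ℝ) * (p ^ i.2 * q ^ i.1) := by
  rw [← (Finset.HasAntidiagonal.sigmaAntidiagonalEquivProd (A := ℕ)).summable_iff,
    summable_sigma_of_nonneg (fun _ => by simp only [Function.comp]; positivity)]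
  refine ⟨fun n => (hasSum_fintype _).summable, ?_⟩
  refine (summable_geometric_of_lt_one (add_nonneg hp hq) h).congr fun n => ?_
  rw [tsum_fintype, add_comm p q, (Commute.all q p).add_pow', ← Finset.sum_coe_sort]
  refine Finset.sum_congr rfl fun i _ => ?_
  have hi := Finset.HasAntidiagonal.mem_antidiagonal.1 i.2
  simp only [Function.comp, Finset.HasAntidiagonal.sigmaAntidiagonalEquivProd_apply]
  rw [show i.1.1 + i.1.2 = n by rw [hi], nsmul_eq_mul, ← Nat.choose_symm_of_eq_add hi.symm]
  ring

variable (ρ α h : ℝ)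

theorem summable_norm_lameCoeff_mul {p q : ℝ} (hp : 0 ≤ p) (hq : 0 ≤ q) (hpq : p + q < 1) :
    Summable fun i : ℕ × ℕ => ‖lameCoeff ρ α h i.1 0 i.2‖ * (p ^ i.2 * q ^ i.1) := by
  obtain ⟨M, -, hM⟩ := exists_norm_lameCoeff_le ρ α h
  refine .of_nonneg_of_le (fun _ => by positivity) (fun i => ?_)
    ((summable_choose_mul_pow_mul_pow hp hq hpq).mul_left M)
  exact (mul_le_mul_of_nonneg_right (hM _ _ _) (by positivity)).trans_eq (by ring)

theorem summable_lameCoeff_mul {x z : ℂ} (hxz : ‖x‖ + ‖z‖ < 1) :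
    Summable fun i : ℕ × ℕ => lameCoeff ρ α h i.1 0 i.2 * (x ^ i.2 * z ^ i.1) :=
  .of_norm_bounded (summable_norm_lameCoeff_mul ρ α h (norm_nonneg x) (norm_nonneg z) hxz)
    fun i => by simp

theorem hasSum_subSeries_mul_pow {x z : ℂ} (hxz : ‖x‖ + ‖z‖ < 1) :
    HasSum (fun n => subSeries ρ α h n x * z ^ n)
      (∑' i : ℕ × ℕ, lameCoeff ρ α h i.1 0 i.2 * (x ^ i.2 * z ^ i.1)) := by
  have hx : ‖x‖ < 1 := by linarith [norm_nonneg z]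
  refine (summable_lameCoeff_mul ρ α h hxz).hasSum.prod_fiberwise fun n => ?_
  rw [subSeries_eq ρ α h hx]
  refine ((summable_lameCoeff ρ α h hx n 0).hasSum.mul_right (z ^ n)).congr_fun fun m => ?_
  ring

section Derivative

variable {ι : Type*} {c : ι → ℂ} {N : ι → ℕ} {r : ℝ} {ξ : ℂ}

theorem differentiableOn_tsum_mul_pow (hs : Summable fun i => ‖c i‖ * r ^ N i) :
    DifferentiableOn ℂ (fun ξ => ∑' i, c i * ξ ^ N i) (Metric.ball 0 r) := by
  refine Complex.differentiableOn_tsum_of_summable_norm hs (fun i => by fun_prop)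
    Metric.isOpen_ball fun i w hw => ?_
  rw [norm_mul, norm_pow]
  have : ‖w‖ ≤ r := by simpa using (Metric.mem_ball.1 hw).le
  gcongr

theorem hasSum_deriv_tsum_mul_pow (hs : Summable fun i => ‖c i‖ * r ^ N i) (hξ : ‖ξ‖ < r) :
    HasSum (fun i => c i * N i * ξ ^ (N i - 1)) (deriv (fun ξ => ∑' i, c i * ξ ^ N i) ξ) := by
  refine (Complex.hasSum_deriv_of_summable_norm (z := ξ) (U := Metric.ball 0 r) hs (F := fun i ξ => c i * ξ ^ N i)
    (fun i => by fun_prop) Metric.isOpen_ball (fun i w hw => ?_) (by simpa using hξ)).congr_fun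
      fun i => ?_
  · rw [norm_mul, norm_pow]
    have : ‖w‖ ≤ r := by simpa using (Metric.mem_ball.1 hw).le
    gcongr
  · simp [mul_assoc]

/-- Shrinking the radius pays for the factor `N i`, because `n (q / r) ^ n` is bounded. -/
theorem summable_norm_mul_natCast_mul_pow (hs : Summable fun i => ‖c i‖ * r ^ N i) {q : ℝ}
    (hq : 0 < q) (hqr : q < r) : Summable fun i => ‖c i * N i‖ * q ^ (N i - 1) := by
  have hr : 0 < r := hq.trans hqr
  have ht : Filter.Tendsto (fun n : ℕ => (n : ℝ) * (q / r) ^ n) Filter.atTop (nhds 0) :=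
    tendsto_self_mul_const_pow_of_lt_one (by positivity) ((div_lt_one hr).2 hqr)
  obtain ⟨C, hC⟩ := ht.bddAbove_range
  refine .of_nonneg_of_le (fun _ => by positivity) (fun i => ?_) (hs.mul_left (C / q))
  have h1 : (N i : ℝ) * (q / r) ^ N i ≤ C := hC ⟨N i, rfl⟩
  rw [div_pow, ← mul_div_assoc, div_le_iff₀ (by positivity)] at h1
  rw [norm_mul, Complex.norm_natCast]
  rcases Nat.eq_zero_or_pos (N i) with h0 | h0
  · simp only [h0, Nat.cast_zero, mul_zero, zero_mul, pow_zero, mul_one] at h1 ⊢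
    exact mul_nonneg (div_nonneg h1 hq.le) (norm_nonneg _)
  · obtain ⟨n, hn⟩ : ∃ n, N i = n + 1 := ⟨N i - 1, by omega⟩
    rw [hn] at h1 ⊢
    have h2 : ((n + 1 : ℕ) : ℝ) * q ^ n ≤ C / q * r ^ (n + 1) := by
      rw [div_mul_eq_mul_div, le_div_iff₀ hq]; rw [pow_succ] at h1; linarith
    calc _ = ‖c i‖ * (((n + 1 : ℕ) : ℝ) * q ^ n) := by simp [mul_assoc]
      _ ≤ ‖c i‖ * (C / q * r ^ (n + 1)) := by gcongr
      _ = _ := by ring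

end Derivative

/-- The sequence `0, v 0, v 1, …`. -/
def shiftSeq (v : ℕ → ℂ) : ℕ → ℂ
  | 0 => 0
  | n + 1 => v n

/-- Padding with a zero at the boundary leaves the sum unchanged, so a recurrence linking
neighbouring pairs can be summed over all pairs at once. -/
theorem hasSum_shift_snd {v : ℕ × ℕ → ℂ} {a : ℂ} (hv : HasSum v a) :
    HasSum (fun p : ℕ × ℕ => shiftSeq (fun j => v (p.1, j)) p.2) a := by
  have hinj : Function.Injective fun p : ℕ × ℕ => (p.1, p.2 + 1) := fun p q hpq => by
    simpa [Prod.ext_iff] using hpq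
  refine (hinj.hasSum_iff ?_).1 hv
  rintro ⟨n, j⟩ hnj
  cases j with
  | zero => rfl
  | succ j => exact absurd ⟨(n, j), rfl⟩ hnj

theorem hasSum_shift_fst {v : ℕ × ℕ → ℂ} {a : ℂ} (hv : HasSum v a) :
    HasSum (fun p : ℕ × ℕ => shiftSeq (fun n => v (n, p.2)) p.1) a := by
  have hinj : Function.Injective fun p : ℕ × ℕ => (p.1 + 1, p.2) := fun p q hpq => by
    simpa [Prod.ext_iff] using hpq
  refine (hinj.hasSum_iff ?_).1 hv
  rintro ⟨n, j⟩ hnj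
  cases n with
  | zero => rfl
  | succ n => exact absurd ⟨(n, j), rfl⟩ hnj

/-- The coefficient, with powers of `1 + ρ²` and `-ρ²`, of `ξ ^ (j + 2 n)`. -/
noncomputable def lameTerm (p : ℕ × ℕ) : ℂ :=
  lameCoeff ρ α h p.1 0 p.2 * ((1 + (ρ : ℂ) ^ 2) ^ p.2 * (-(ρ : ℂ) ^ 2) ^ p.1)

/-- The exponent of `ξ` attached to the pair `(n, j)`. -/
def lameExp (p : ℕ × ℕ) : ℕ := p.2 + 2 * p.1

theorem stepRatio_mul (a : ℕ) : stepRatio ρ h a * (((a : ℂ) + 1) * (a + 3 / 2)) =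
    ((a : ℂ) + 1 / 2) ^ 2 - sigma ρ h ^ 2 := by
  refine div_mul_cancel₀ _ (mul_ne_zero ?_ ?_)
  · exact_mod_cast (by positivity : (a : ℝ) + 1 ≠ 0)
  · simpa using Complex.ofReal_ne_zero.2 (by positivity : (a : ℝ) + 3 / 2 ≠ 0)

theorem weight_mul (a : ℕ) : weight α 0 a * (((a : ℂ) + 5 / 2) * (a + 2)) =
    ((a : ℂ) + α / 2 + 1) * (a - α / 2 + 1 / 2) := by
  have h1 : (a : ℂ) + 5 / 2 ≠ 0 := by
    simpa using Complex.ofReal_ne_zero.2 (by positivity : (a : ℝ) + 5 / 2 ≠ 0)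
  have h2 : (a : ℂ) + 2 ≠ 0 := by
    simpa using Complex.ofReal_ne_zero.2 (by positivity : (a : ℝ) + 2 ≠ 0)
  rw [weight]
  simp only [Nat.cast_zero, mul_zero, add_zero]
  exact div_mul_cancel₀ _ (mul_ne_zero h1 h2)

/-- The recurrence by the last step, cleared of denominators. A unit step from `a = N - 1` has
denominator `(a + 1)(a + 3/2)`, a double step from `a = N - 2` has `(a + 2)(a + 5/2)`; both equal `N
(N + 1/2)`. -/
theorem lameTerm_recurrence (ξ : ℂ) (p : ℕ × ℕ) :
    (lameExp p : ℂ) * (lameExp p + 1 / 2) * (lameTerm ρ α h p * ξ ^ lameExp p) =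
      shiftSeq (fun j => (1 + (ρ : ℂ) ^ 2) * ξ *
        ((((lameExp (p.1, j) : ℂ) + 1 / 2) ^ 2 - sigma ρ h ^ 2) *
          (lameTerm ρ α h (p.1, j) * ξ ^ lameExp (p.1, j)))) p.2 +
      shiftSeq (fun n => -(ρ : ℂ) ^ 2 * ξ ^ 2 *
        (((lameExp (n, p.2) : ℂ) + α / 2 + 1) * (lameExp (n, p.2) - α / 2 + 1 / 2) *
          (lameTerm ρ α h (n, p.2) * ξ ^ lameExp (n, p.2)))) p.1 := by
  obtain ⟨n, j⟩ := p
  cases n with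
  | zero =>
    cases j with
    | zero => simp [lameExp, shiftSeq]
    | succ j =>
      have h1 := stepRatio_mul ρ h j
      simp only [shiftSeq, lameExp, lameTerm, lameCoeff, pathSum_zero_succ, zero_add, mul_zero, add_zero,
        pow_zero, mul_one]
      rw [← h1, pow_succ, pow_succ]
      push_cast
      ring
  | succ n =>
    cases j with
    | zero =>
      have h1 := weight_mul α (2 * n)
      simp only [shiftSeq, lameExp, lameTerm, lameCoeff, pathSum_succ_zero, zero_add]
      rw [← h1, pow_succ, mul_add 2 n 1, pow_add]
      push_cast
      ring
    | succ j =>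
      have h1 := stepRatio_mul ρ h (2 * n + j + 2)
      have h2 := weight_mul α (2 * n + j + 1)
      simp only [shiftSeq, lameExp, lameTerm, lameCoeff, pathSum_succ_succ, zero_add]
      rw [show j + 2 * (n + 1) = 2 * n + j + 2 by ring, show j + 1 + 2 * n = 2 * n + j + 1 by ring,
        ← h1, ← h2, show j + 1 + 2 * (n + 1) = 2 * n + j + 1 + 2 by ring, pow_add,
        show ξ ^ (2 * n + j + 2) = ξ ^ (2 * n + j + 1) * ξ by rw [← pow_succ],
        pow_succ _ n]
      push_cast
      ring

/-- The holomorphic factor of `LS^R`. -/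
noncomputable def lameSeries (ξ : ℂ) : ℂ := ∑' p, lameTerm ρ α h p * ξ ^ lameExp p

theorem LS_eq {ξ : ℂ} (hξ : ‖eta ρ ξ‖ + ‖zvar ρ ξ‖ < 1) :
    LS ρ α h ξ = ξ ^ (1 / 2 : ℂ) * lameSeries ρ α h ξ := by
  rw [LS, (hasSum_subSeries_mul_pow ρ α h hξ).tsum_eq, lameSeries]
  congr 1
  refine tsum_congr fun p => ?_
  rw [lameTerm, eta, zvar, lameExp, mul_pow, mul_pow, pow_add, pow_mul]
  ring

theorem norm_eta_add_norm_zvar (ξ : ℂ) :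
    ‖eta ρ ξ‖ + ‖zvar ρ ξ‖ = (1 + ρ ^ 2) * ‖ξ‖ + ρ ^ 2 * ‖ξ‖ ^ 2 := by
  have h1 : (1 + (ρ : ℂ) ^ 2) = ((1 + ρ ^ 2 : ℝ) : ℂ) := by push_cast; rfl
  rw [eta, zvar, norm_mul, norm_mul, h1, Complex.norm_real, norm_neg, norm_pow, norm_pow,
    Complex.norm_real, Real.norm_of_nonneg (by positivity), Real.norm_eq_abs, sq_abs]

theorem exists_radius {s : ℝ} (hs : (1 + ρ ^ 2) * s + ρ ^ 2 * s ^ 2 < 1) :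
    ∃ r, s < r ∧ (1 + ρ ^ 2) * r + ρ ^ 2 * r ^ 2 < 1 := by
  have hc : ContinuousAt (fun r : ℝ => (1 + ρ ^ 2) * r + ρ ^ 2 * r ^ 2) s := by fun_prop
  have h1 := (hc.eventually (gt_mem_nhds hs)).filter_mono
    (nhdsWithin_le_nhds (s := Set.Ioi s))
  obtain ⟨r, hr, hr'⟩ := (h1.and (self_mem_nhdsWithin : Set.Ioi s ∈ nhdsWithin s (Set.Ioi s))).exists
  exact ⟨r, hr', hr⟩

theorem summable_norm_lameTerm {r : ℝ} (hr0 : 0 ≤ r) (hr : (1 + ρ ^ 2) * r + ρ ^ 2 * r ^ 2 < 1) :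
    Summable fun p => ‖lameTerm ρ α h p‖ * r ^ lameExp p := by
  refine (summable_norm_lameCoeff_mul ρ α h (p := (1 + ρ ^ 2) * r) (q := ρ ^ 2 * r ^ 2)
    (by positivity) (by positivity) hr).congr fun p => ?_
  have h1 : (1 + (ρ : ℂ) ^ 2) = ((1 + ρ ^ 2 : ℝ) : ℂ) := by push_cast; rfl
  rw [lameTerm, norm_mul, norm_mul, norm_pow, norm_pow, h1, Complex.norm_real, norm_neg, norm_pow,
    Complex.norm_real, Real.norm_of_nonneg (by positivity), Real.norm_eq_abs, sq_abs, lameExp,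
    pow_add, pow_mul, mul_pow, mul_pow]
  ring

theorem isOpen_lameDomain :
    IsOpen {ξ : ℂ | ξ ∈ Complex.slitPlane ∧ ‖eta ρ ξ‖ + ‖zvar ρ ξ‖ < 1} := by
  simp only [norm_eta_add_norm_zvar]
  have hc : Continuous fun ξ : ℂ => (1 + ρ ^ 2) * ‖ξ‖ + ρ ^ 2 * ‖ξ‖ ^ 2 := by fun_prop
  exact Complex.isOpen_slitPlane.inter (isOpen_lt hc continuous_const)

theorem lameSeries_deriv {ξ : ℂ} (hξ : ‖eta ρ ξ‖ + ‖zvar ρ ξ‖ < 1) :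
    DifferentiableAt ℂ (lameSeries ρ α h) ξ ∧
    DifferentiableAt ℂ (deriv (lameSeries ρ α h)) ξ ∧
    HasSum (fun p => lameTerm ρ α h p * ξ ^ lameExp p) (lameSeries ρ α h ξ) ∧
    HasSum (fun p => lameExp p * (lameTerm ρ α h p * ξ ^ lameExp p))
      (ξ * deriv (lameSeries ρ α h) ξ) ∧
    HasSum (fun p => lameExp p * ((lameExp p : ℂ) - 1) * (lameTerm ρ α h p * ξ ^ lameExp p))
      (ξ ^ 2 * deriv (deriv (lameSeries ρ α h)) ξ) := by
  rw [norm_eta_add_norm_zvar] at hξ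
  obtain ⟨r, hr, hr1⟩ := exists_radius ρ hξ
  -- The second termwise differentiation takes place in a smaller disc, of radius `q`.
  obtain ⟨q, hq, hqr⟩ := exists_between hr
  have hq0 : 0 < q := (norm_nonneg ξ).trans_lt hq
  have hr0 : 0 < r := hq0.trans hqr
  have hs := summable_norm_lameTerm ρ α h hr0.le hr1
  have hd : DifferentiableOn ℂ (lameSeries ρ α h) (Metric.ball 0 r) :=
    differentiableOn_tsum_mul_pow hs
  have hmem : Metric.ball (0 : ℂ) r ∈ nhds ξ := Metric.isOpen_ball.mem_nhds (by simpa using hr)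
  have hd' := hd.deriv Metric.isOpen_ball
  have h1 := hasSum_deriv_tsum_mul_pow hs hr
  have hs' := summable_norm_mul_natCast_mul_pow hs hq0 hqr
  have h2 := hasSum_deriv_tsum_mul_pow hs' hq
  have he : (fun ξ => ∑' p, lameTerm ρ α h p * lameExp p * ξ ^ (lameExp p - 1)) =ᶠ[nhds ξ]
      deriv (lameSeries ρ α h) := by
    filter_upwards [hmem] with w hw
    exact (hasSum_deriv_tsum_mul_pow hs (by simpa using hw)).tsum_eq
  rw [he.deriv_eq] at h2
  refine ⟨hd.differentiableAt hmem, hd'.differentiableAt hmem, ?_, ?_, ?_⟩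
  · refine Summable.hasSum (.of_norm_bounded hs fun p => ?_)
    rw [norm_mul, norm_pow]; gcongr
  · refine (h1.mul_left ξ).congr_fun fun p => ?_
    rcases hp : lameExp p with _ | n
    · simp
    · rw [Nat.add_sub_cancel, pow_succ]; ring
  · refine (h2.mul_left (ξ ^ 2)).congr_fun fun p => ?_
    rcases hp : lameExp p with _ | _ | n
    · simp
    · simp
    · rw [show n + 1 + 1 - 1 - 1 = n by omega, show n + 1 + 1 - 1 = n + 1 by omega, pow_add,
        pow_add]
      push_cast
      ring

/-- Summation of `lameTerm_recurrence`: each quadratic polynomial in the exponent `N` is expanded in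
`N (N - 1)`, `N`, 1, which correspond to `ξ² ∂²`, `ξ ∂` and the identity. -/
theorem lameSeries_ode {ξ : ℂ} (hξ : ‖eta ρ ξ‖ + ‖zvar ρ ξ‖ < 1) :
    ξ ^ 2 * deriv (deriv (lameSeries ρ α h)) ξ + 3 / 2 * (ξ * deriv (lameSeries ρ α h) ξ) =
      (1 + (ρ : ℂ) ^ 2) * ξ * (ξ ^ 2 * deriv (deriv (lameSeries ρ α h)) ξ +
        2 * (ξ * deriv (lameSeries ρ α h) ξ) +
        (1 / 4 - sigma ρ h ^ 2) * lameSeries ρ α h ξ) +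
      -(ρ : ℂ) ^ 2 * ξ ^ 2 * (ξ ^ 2 * deriv (deriv (lameSeries ρ α h)) ξ +
        5 / 2 * (ξ * deriv (lameSeries ρ α h) ξ) +
        (α / 2 + 1) * (1 / 2 - α / 2) * lameSeries ρ α h ξ) := by
  obtain ⟨-, -, h0, h1, h2⟩ := lameSeries_deriv ρ α h hξ
  have hV := (((h2.add (h1.mul_left 2)).add (h0.mul_left (1 / 4 - sigma ρ h ^ 2))).mul_left
    ((1 + (ρ : ℂ) ^ 2) * ξ))
  have hW := (((h2.add (h1.mul_left (5 / 2))).add (h0.mul_left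
    (((α : ℂ) / 2 + 1) * (1 / 2 - α / 2)))).mul_left (-(ρ : ℂ) ^ 2 * ξ ^ 2))
  refine (h2.add (h1.mul_left (3 / 2))).unique
    (((hasSum_shift_snd hV).add (hasSum_shift_fst hW)).congr_fun fun p => ?_)
  have hrec := lameTerm_recurrence ρ α h ξ p
  have e : (lameExp p : ℂ) * ((lameExp p : ℂ) - 1) * (lameTerm ρ α h p * ξ ^ lameExp p) +
      3 / 2 * (lameExp p * (lameTerm ρ α h p * ξ ^ lameExp p)) =
      (lameExp p : ℂ) * (lameExp p + 1 / 2) * (lameTerm ρ α h p * ξ ^ lameExp p) := by ring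
  rw [e, hrec]
  obtain ⟨n, j⟩ := p
  congr 1
  · cases j with
    | zero => rfl
    | succ j => simp only [shiftSeq]; ring
  · cases n with
    | zero => rfl
    | succ n => simp only [shiftSeq]; ring

theorem differentiableOn_LS : DifferentiableOn ℂ (LS ρ α h)
    {ξ : ℂ | ξ ∈ Complex.slitPlane ∧ ‖eta ρ ξ‖ + ‖zvar ρ ξ‖ < 1} := by
  refine DifferentiableOn.congr (f := fun ξ => ξ ^ (1 / 2 : ℂ) * lameSeries ρ α h ξ) ?_
    fun ξ hξ => LS_eq ρ α h hξ.2
  intro ξ hξ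
  exact ((differentiableAt_id.cpow_const hξ.1).mul
    (lameSeries_deriv ρ α h hξ.2).1).differentiableWithinAt

theorem deriv_cpow_half_mul {F : ℂ → ℂ} {ξ : ℂ} (hξ : ξ ∈ Complex.slitPlane)
    (hF : DifferentiableAt ℂ F ξ) :
    deriv (fun ξ => ξ ^ (1 / 2 : ℂ) * F ξ) ξ =
      ξ ^ (1 / 2 : ℂ) * (F ξ / (2 * ξ) + deriv F ξ) := by
  have h0 := Complex.slitPlane_ne_zero hξ
  have h1 : HasDerivAt (fun ξ : ℂ => ξ ^ (1 / 2 : ℂ)) (1 / 2 * ξ ^ (1 / 2 - 1 : ℂ)) ξ := by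
    simpa using (hasDerivAt_id ξ).cpow_const (c := 1 / 2) hξ
  rw [(h1.fun_mul hF.hasDerivAt).deriv, Complex.cpow_sub _ _ h0, Complex.cpow_one]
  field_simp

theorem lameEquationAt_LS (hρ0 : 0 < ρ) (hρ1 : ρ < 1) {ξ : ℂ} (hξ : ξ ∈ Complex.slitPlane)
    (hξ' : ‖eta ρ ξ‖ + ‖zvar ρ ξ‖ < 1) : LameEquationAt ρ α h (LS ρ α h) ξ := by
  have hU := isOpen_lameDomain ρ
  have hmem := hU.mem_nhds (show ξ ∈ {ξ : ℂ | _} from ⟨hξ, hξ'⟩)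
  obtain ⟨d1, d2, -⟩ := lameSeries_deriv ρ α h hξ'
  have ode := lameSeries_ode ρ α h hξ'
  have h0 := Complex.slitPlane_ne_zero hξ
  have e0 : LS ρ α h =ᶠ[nhds ξ] fun ξ => ξ ^ (1 / 2 : ℂ) * lameSeries ρ α h ξ := by
    filter_upwards [hmem] with w hw using LS_eq ρ α h hw.2
  have e1 : deriv (LS ρ α h) =ᶠ[nhds ξ] fun ξ => ξ ^ (1 / 2 : ℂ) *
      (lameSeries ρ α h ξ / (2 * ξ) + deriv (lameSeries ρ α h) ξ) := by
    filter_upwards [e0.eventuallyEq_nhds, hmem] with w hw hw'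
    rw [hw.deriv_eq, deriv_cpow_half_mul hw'.1 (lameSeries_deriv ρ α h hw'.2).1]
  have d3 : HasDerivAt (fun ξ => lameSeries ρ α h ξ / (2 * ξ) + deriv (lameSeries ρ α h) ξ)
      ((deriv (lameSeries ρ α h) ξ * (2 * ξ) - lameSeries ρ α h ξ * (2 * 1)) / (2 * ξ) ^ 2 +
        deriv (deriv (lameSeries ρ α h)) ξ) ξ :=
    (d1.hasDerivAt.div ((hasDerivAt_id ξ).const_mul 2) (by simpa using h0)).add d2.hasDerivAt
  have e2 := e1.deriv_eq
  rw [deriv_cpow_half_mul hξ d3.differentiableAt, d3.deriv] at e2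
  rw [LameEquationAt, e2, e1.eq_of_nhds, e0.eq_of_nhds]
  -- This keeps `ξ` away from the singular points `1` and `ρ⁻²`.
  have hn : ‖ξ‖ < 1 := by
    rw [norm_eta_add_norm_zvar] at hξ'
    nlinarith [norm_nonneg ξ, sq_nonneg ρ, sq_nonneg ‖ξ‖, mul_nonneg (sq_nonneg ρ) (norm_nonneg ξ),
      mul_nonneg (sq_nonneg ρ) (sq_nonneg ‖ξ‖)]
  have n1 : ξ - 1 ≠ 0 := fun hc => by
    rw [sub_eq_zero.1 hc] at hn; simp at hn
  have hρc : (ρ : ℂ) ≠ 0 := by exact_mod_cast hρ0.ne'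
  have n2 : (ρ : ℂ) ^ 2 * ξ - 1 ≠ 0 := fun hc => by
    have : ‖(ρ : ℂ) ^ 2 * ξ‖ = 1 := by rw [sub_eq_zero.1 hc]; simp
    rw [norm_mul, norm_pow, Complex.norm_real, Real.norm_of_nonneg hρ0.le] at this
    nlinarith [norm_nonneg ξ]
  have n3 : ξ - ((ρ : ℂ) ^ 2)⁻¹ = ((ρ : ℂ) ^ 2 * ξ - 1) / (ρ : ℂ) ^ 2 := by field_simp
  have hs : (1 + (ρ : ℂ) ^ 2) * sigma ρ h ^ 2 = h / 4 := by
    have n4 : (1 + (ρ : ℂ) ^ 2) ≠ 0 := by exact_mod_cast (by positivity : 1 + ρ ^ 2 ≠ 0)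
    rw [sigma_sq]; push_cast; field_simp
  rw [n3]
  generalize deriv (deriv (lameSeries ρ α h)) ξ = S2 at *
  generalize deriv (lameSeries ρ α h) ξ = S1 at *
  generalize lameSeries ρ α h ξ = S0 at *
  have hs' : (h : ℂ) = 4 * ((1 + (ρ : ℂ) ^ 2) * sigma ρ h ^ 2) := by rw [hs]; ring
  rw [hs']
  generalize ξ ^ (1 / 2 : ℂ) = X at *
  generalize hD : (ρ : ℂ) ^ 2 * ξ - 1 = D at *
  field_simp
  rw [← hD]
  -- With denominators cleared, the Lamé equation is `16 ξ ^ (1/2)` times the equation of the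
  -- holomorphic factor.
  linear_combination 16 * X * ode

end LameEquation

section Operators

/-! ### Power series in the unit disc and the differential operator -/

/-- The sum of a power series. -/
noncomputable def powSum (c : ℕ → ℂ) (w : ℂ) : ℂ := ∑' j, c j * w ^ j

/-- The power series with coefficients `c` converges absolutely in the unit disc. -/
def DiscSummable (c : ℕ → ℂ) : Prop := ∀ q : ℝ, 0 < q → q < 1 → Summable fun j => ‖c j‖ * q ^ j

section Disc

variable {c : ℕ → ℂ} {w : ℂ}

theorem DiscSummable.summable (hc : DiscSummable c) (hw : ‖w‖ < 1) : Summable fun j => c j * w ^ j := by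
  obtain ⟨q, hq, hq1⟩ := exists_between hw
  refine .of_norm_bounded (hc q ((norm_nonneg w).trans_lt hq) hq1) fun j => ?_
  rw [norm_mul, norm_pow]
  gcongr

theorem DiscSummable.hasSum (hc : DiscSummable c) (hw : ‖w‖ < 1) : HasSum (fun j => c j * w ^ j) (powSum c w) :=
  (hc.summable hw).hasSum

theorem DiscSummable.differentiableOn (hc : DiscSummable c) :
    DifferentiableOn ℂ (powSum c) (Metric.ball 0 1) := by
  intro w hw
  have hw : ‖w‖ < 1 := by simpa using hw
  obtain ⟨q, hq, hq1⟩ := exists_between hw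
  have h1 := differentiableOn_tsum_mul_pow (N := id) (hc q ((norm_nonneg w).trans_lt hq) hq1)
  exact (h1.differentiableAt
    (Metric.isOpen_ball.mem_nhds (by simpa using hq))).differentiableWithinAt

theorem DiscSummable.natCast_add_mul (hc : DiscSummable c) (a : ℂ) :
    DiscSummable fun j => ((j : ℂ) + a) * c j := by
  intro q hq0 hq1
  obtain ⟨r, hr, hr1⟩ := exists_between hq1
  have h1 := summable_norm_mul_natCast_mul_pow (N := id) (hc r (hq0.trans hr) hr1) hq0 hr
  refine .of_nonneg_of_le (fun _ => by positivity) (fun j => ?_)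
    ((h1.mul_left q).add ((hc q hq0 hq1).mul_left ‖a‖))
  have e : ‖c j * j‖ * q ^ j = q * (‖c j * (id j : ℕ)‖ * q ^ (id j - 1)) := by
    rcases j with _ | j
    · simp
    · simp [pow_succ]; ring
  rw [← e]
  calc _ ≤ (‖c j * j‖ + ‖a‖ * ‖c j‖) * q ^ j := by
        refine mul_le_mul_of_nonneg_right ?_ (by positivity)
        beta_reduce
        rw [add_mul, mul_comm (j : ℂ), ← norm_mul]
        exact norm_add_le _ _
    _ = _ := by ring

theorem DiscSummable.euler (hc : DiscSummable c) (hw : ‖w‖ < 1) (a : ℂ) :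
    a * powSum c w + w * deriv (powSum c) w = powSum (fun j => ((j : ℂ) + a) * c j) w := by
  obtain ⟨q, hq, hq1⟩ := exists_between hw
  have h1 := hasSum_deriv_tsum_mul_pow (N := id) (hc q ((norm_nonneg w).trans_lt hq) hq1) hq
  have h2 := ((hc.hasSum hw).mul_left a).add (h1.mul_left w)
  refine h2.unique (((hc.natCast_add_mul a).hasSum hw).congr_fun fun j => ?_)
  rcases j with _ | j
  · simp
  · simp [pow_succ]; ring

end Disc

theorem hasDerivAt_localPow {w₀ w : ℂ} (hw₀ : w₀ ≠ 0) (s : ℂ) (hw : w / w₀ ∈ Complex.slitPlane) :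
    HasDerivAt (localPow w₀ s) (s / w * localPow w₀ s w) w := by
  have hw0 : w ≠ 0 := fun h0 => Complex.slitPlane_ne_zero hw (by simp [h0])
  have h1 : HasDerivAt (fun w => Complex.log (w / w₀)) (1 / w₀ / (w / w₀)) w :=
    ((hasDerivAt_id w).div_const w₀).clog hw
  convert! ((h1.const_add (Complex.log w₀)).const_mul s).cexp using 1
  rw [localPow]
  field_simp

theorem localPow_add (w₀ s s' w : ℂ) :
    localPow w₀ (s + s') w = localPow w₀ s w * localPow w₀ s' w := by
  rw [localPow, localPow, localPow, ← Complex.exp_add]; ring_nf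

theorem eventually_div_mem_slitPlane {w₀ : ℂ} (hw₀ : w₀ ≠ 0) :
    ∀ᶠ w in nhds w₀, w / w₀ ∈ Complex.slitPlane := by
  have hc : ContinuousAt (fun w => w / w₀) w₀ := by fun_prop
  exact hc.eventually_mem (Complex.isOpen_slitPlane.mem_nhds (by simp [hw₀]))

/-- Since `w ^ (-s) (w ∂) w ^ s = w ∂ + s`, the condition `b + d = a` makes the operator `(w ∂ +
a)(w ∂ + d)`: all powers cancel and the branch is immaterial. Only the germ of `f` at `w₀` matters,
so agreement on the punctured disc suffices. -/
theorem eulerOp_eq_powSum {a b d : ℂ} (habd : b + d = a) {c : ℕ → ℂ} (hc : DiscSummable c)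
    {f : ℂ → ℂ} (hf : ∀ w, w ≠ 0 → ‖w‖ < 1 → f w = powSum c w) {w₀ : ℂ} (hw₀ : w₀ ≠ 0)
    (hw₀' : ‖w₀‖ < 1) :
    eulerOp a b d f w₀ = powSum (fun j => ((j : ℂ) + a) * (((j : ℂ) + d) * c j)) w₀ := by
  have hball : ∀ᶠ w in nhds w₀, w ≠ 0 ∧ ‖w‖ < 1 :=
    (eventually_ne_nhds hw₀).and
      (continuous_norm.continuousAt.eventually_lt_const hw₀')
  have hd : ∀ {c : ℕ → ℂ} {w : ℂ}, DiscSummable c → ‖w‖ < 1 → HasDerivAt (powSum c)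
      (deriv (powSum c) w) w := fun hc hw =>
    (hc.differentiableOn.differentiableAt
      (Metric.isOpen_ball.mem_nhds (by simpa using hw))).hasDerivAt
  have hstep : ∀ (s : ℂ) {c : ℕ → ℂ}, DiscSummable c → ∀ w, w ≠ 0 → ‖w‖ < 1 →
      w / w₀ ∈ Complex.slitPlane → w * deriv (fun w => localPow w₀ s w * powSum c w) w =
        localPow w₀ s w * powSum (fun j => ((j : ℂ) + s) * c j) w := by
    intro s c hc w h0 h1 hs
    rw [((hasDerivAt_localPow hw₀ s hs).fun_mul (hd hc h1)).deriv, ← hc.euler h1]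
    field_simp
  have hc' := hc.natCast_add_mul d
  have e1 : (fun w => localPow w₀ b w * (w * deriv (fun w' => localPow w₀ d w' * f w') w))
      =ᶠ[nhds w₀] fun w => localPow w₀ a w * powSum (fun j => ((j : ℂ) + d) * c j) w := by
    have h1 : ∀ᶠ w in nhds w₀, (fun w' => localPow w₀ d w' * f w') =ᶠ[nhds w]
        fun w' => localPow w₀ d w' * powSum c w' := by
      filter_upwards [hball.eventually_nhds] with w hw
      filter_upwards [hw] with w' hw' using by rw [hf w' hw'.1 hw'.2]
    filter_upwards [h1, hball, eventually_div_mem_slitPlane hw₀] with w hw hw' hs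
    rw [hw.deriv_eq, hstep d hc w hw'.1 hw'.2 hs, ← mul_assoc, ← localPow_add, habd]
  rw [eulerOp, e1.deriv_eq, hstep a hc' w₀ hw₀ hw₀' (eventually_div_mem_slitPlane hw₀).self_of_nhds,
    ← mul_assoc, ← localPow_add, neg_add_cancel]
  simp [localPow]

/-! ### The contour integral -/

/-- The coefficient `(a)_n / n!` of the binomial series. -/
noncomputable def binCoeff (a : ℂ) (n : ℕ) : ℂ := poch a n / n.factorial

theorem hasSum_one_sub_cpow (a : ℂ) {y : ℂ} (hy : ‖y‖ < 1) :
    HasSum (fun n => binCoeff a n * y ^ n) ((1 - y) ^ (-a)) := by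
  have h1 := (Complex.one_div_one_sub_cpow_hasFPowerSeriesOnBall_zero a).hasSum (y := y)
    (by simpa [enorm_eq_nnnorm, ← NNReal.coe_lt_coe] using hy)
  simp only [FormalMultilinearSeries.ofScalars_apply_eq, zero_add, smul_eq_mul] at h1
  rw [Complex.cpow_neg, ← one_div]
  refine h1.congr_fun fun n => ?_
  have h2 := Ring.factorial_nsmul_multichoose_eq_ascPochhammer a n
  rw [Polynomial.ascPochhammer_smeval_eq_eval, nsmul_eq_mul] at h2
  rw [binCoeff, poch, ← h2, Ring.choose, mul_div_cancel_left₀ _ (by simp [Nat.factorial_ne_zero])]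
  congr 3
  ring

theorem hasSum_circleIntegral {ι : Type*} [Countable ι] {F : ι → ℂ → ℂ} {f : ℂ → ℂ} {b : ι → ℝ}
    {r : ℝ} (hr : 0 ≤ r) (hF : ∀ i, ContinuousOn (F i) (Metric.sphere 0 r))
    (hb : ∀ i, ∀ v ∈ Metric.sphere (0 : ℂ) r, ‖F i v‖ ≤ b i) (hs : Summable b)
    (hf : ∀ v ∈ Metric.sphere (0 : ℂ) r, HasSum (fun i => F i v) (f v)) :
    HasSum (fun i => ∮ v in C(0, r), F i v) (∮ v in C(0, r), f v) := by
  simp only [circleIntegral]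
  have hm : ∀ θ, circleMap 0 r θ ∈ Metric.sphere (0 : ℂ) r := circleMap_mem_sphere 0 hr
  refine intervalIntegral.hasSum_integral_of_dominated_convergence (fun i _ => r * b i)
    (fun i => ?_) (fun i => ?_) ?_ ?_ ?_
  · refine Continuous.aestronglyMeasurable ?_
    simp only [deriv_circleMap]
    exact ((continuous_circleMap 0 r).mul continuous_const).smul
      ((hF i).comp_continuous (continuous_circleMap 0 r) hm)
  · refine .of_forall fun θ _ => ?_
    rw [norm_smul, deriv_circleMap, norm_mul, norm_circleMap_zero, Complex.norm_I, mul_one,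
      abs_of_nonneg hr]
    exact mul_le_mul_of_nonneg_left (hb i _ (hm θ)) hr
  · exact .of_forall fun _ _ => hs.mul_left r
  · exact intervalIntegrable_const
  · exact .of_forall fun θ _ => (hf _ (hm θ)).const_smul _

theorem circleIntegral_zpow (r : ℝ) (hr : r ≠ 0) (d e : ℕ) :
    (∮ v in C(0, r), v ^ ((e : ℤ) - d - 1)) = if d = e then 2 * Real.pi * Complex.I else 0 := by
  split_ifs with h
  · have := circleIntegral.integral_sub_center_inv 0 hr
    subst h
    simpa using this
  · have := circleIntegral.integral_sub_zpow_of_ne (n := (e : ℤ) - d - 1) (by omega) 0 0 r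
    simpa using this

/-- On the circle `|v⁻¹| < 1` and `|X v| < 1`, so both binomial series converge; integration against
`v⁻¹` keeps only the diagonal terms. -/
theorem hasSum_circleIntegral_cpow (a b : ℂ) {X : ℂ} {r : ℝ} (hr : 1 < r) (hX : ‖X‖ * r < 1) :
    HasSum (fun d => 2 * Real.pi * Complex.I * (binCoeff a d * binCoeff b d * X ^ d))
      (∮ v in C(0, r), v⁻¹ * (1 - v⁻¹) ^ (-a) * (1 - X * v) ^ (-b)) := by
  have hr0 : 0 < r := one_pos.trans hr
  have hri : ‖(r⁻¹ : ℂ)‖ < 1 := by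
    rw [norm_inv, Complex.norm_real, Real.norm_of_nonneg hr0.le]; exact inv_lt_one_of_one_lt₀ hr
  have hXr : ‖X * r‖ < 1 := by rwa [norm_mul, Complex.norm_real, Real.norm_of_nonneg hr0.le]
  have hsa := (hasSum_one_sub_cpow a hri).summable.norm
  have hsb := (hasSum_one_sub_cpow b hXr).summable.norm
  have h1 := hasSum_circleIntegral (r := r) (ι := ℕ × ℕ)
    (F := fun p v => v⁻¹ * ((binCoeff a p.1 * v⁻¹ ^ p.1) * (binCoeff b p.2 * (X * v) ^ p.2)))
    (f := fun v => v⁻¹ * (1 - v⁻¹) ^ (-a) * (1 - X * v) ^ (-b))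
    (b := fun p => r⁻¹ * (‖binCoeff a p.1 * (r : ℂ)⁻¹ ^ p.1‖ * ‖binCoeff b p.2 * (X * r) ^ p.2‖))
    hr0.le ?_ ?_ ?_ ?_
  · have hdiag : Function.Injective fun d : ℕ => (d, d) := fun _ _ h => (Prod.ext_iff.1 h).1
    have h2 : ∀ p : ℕ × ℕ, (∮ v in C(0, r), v⁻¹ * ((binCoeff a p.1 * v⁻¹ ^ p.1) *
        (binCoeff b p.2 * (X * v) ^ p.2))) = binCoeff a p.1 * binCoeff b p.2 * X ^ p.2 *
          if p.1 = p.2 then 2 * Real.pi * Complex.I else 0 := fun p => by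
      rw [← circleIntegral_zpow r hr0.ne', ← circleIntegral.integral_const_mul]
      refine circleIntegral.integral_congr hr0.le fun v hv => ?_
      have hv0 : v ≠ 0 := by rintro rfl; simp [hr0.ne] at hv
      simp only [zpow_sub₀ hv0, zpow_natCast, zpow_one, mul_pow, inv_pow]
      field_simp
    simp only [h2] at h1
    refine ((hdiag.hasSum_iff ?_).2 h1).congr_fun fun d => ?_
    · rintro ⟨d, e⟩ hde
      have : d ≠ e := fun h => hde ⟨d, by simp [h]⟩
      simp [this]
    · simp; ring
  · intro p v hv
    have hv0 : v ≠ 0 := by rintro rfl; simp [hr0.ne] at hv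
    refine ContinuousAt.continuousWithinAt ?_
    fun_prop (disch := assumption)
  · intro p v hv
    have hv : ‖v‖ = r := by simpa using hv
    simp [hv, abs_of_pos hr0]
  · exact (hsa.mul_of_nonneg hsb (fun _ => norm_nonneg _) (fun _ => norm_nonneg _)).mul_left _
  · intro v hv
    have hv : ‖v‖ = r := by simpa using hv
    have ha := hasSum_one_sub_cpow a (y := v⁻¹) (by
      rw [norm_inv, hv]; exact inv_lt_one_of_one_lt₀ hr)
    have hb := hasSum_one_sub_cpow b (y := X * v) (by rwa [norm_mul, hv])
    have h3 : Summable fun p : ℕ × ℕ =>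
        (binCoeff a p.1 * v⁻¹ ^ p.1) * (binCoeff b p.2 * (X * v) ^ p.2) :=
      summable_mul_of_summable_norm (f := fun d => binCoeff a d * v⁻¹ ^ d)
        (g := fun d => binCoeff b d * (X * v) ^ d) ha.summable.norm hb.summable.norm
    have h4 := (ha.mul hb h3).mul_left v⁻¹
    rwa [← mul_assoc] at h4

end Operators

section Bounds

/-! ### The contour integral of a power series in the substituted variable -/

section Contour

variable {X p A B : ℂ} {r : ℝ} {e : ℕ → ℂ}

theorem one_sub_inv_mem_slitPlane {v : ℂ} (hv : 1 < ‖v‖) : 1 - v⁻¹ ∈ Complex.slitPlane := by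
  rw [sub_eq_add_neg]
  exact Complex.mem_slitPlane_of_norm_lt_one (by
    rw [norm_neg, norm_inv]; exact inv_lt_one_of_one_lt₀ hv)

theorem one_sub_mul_mem_slitPlane {v : ℂ} (hv : ‖X‖ * ‖v‖ < 1) :
    1 - X * v ∈ Complex.slitPlane := by
  rw [sub_eq_add_neg]
  exact Complex.mem_slitPlane_of_norm_lt_one (by rwa [norm_neg, norm_mul])

theorem cpow_neg_mul_inv_pow {z : ℂ} (hz : z ≠ 0) (a : ℂ) (j : ℕ) :
    z ^ (-a) * z⁻¹ ^ j = z ^ (-(a + j)) := by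
  rw [neg_add, Complex.cpow_add _ _ hz, Complex.cpow_neg _ (j : ℂ), Complex.cpow_natCast, inv_pow]

theorem continuousOn_contour_factor (hr : 1 < r) (hX : ‖X‖ * r < 1) :
    ContinuousOn (fun v => v⁻¹ * (1 - v⁻¹) ^ (-A) * (1 - X * v) ^ (-B)) (Metric.sphere 0 r) := by
  intro v hv
  have hv : ‖v‖ = r := by simpa using hv
  have hv0 : v ≠ 0 := by rintro rfl; simp at hv; linarith
  have hi : ContinuousAt (fun v : ℂ => v⁻¹) v := continuousAt_inv₀ hv0
  have c2 : ContinuousAt (fun v : ℂ => 1 - X * v) v := by fun_prop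
  exact ((hi.mul ((continuousAt_const.sub hi).cpow continuousAt_const
    (one_sub_inv_mem_slitPlane (hv.symm ▸ hr)))).mul (c2.cpow continuousAt_const
      (one_sub_mul_mem_slitPlane (hv.symm ▸ hX)))).continuousWithinAt

theorem continuousOn_contour_arg (hr : 1 < r) (hX : ‖X‖ * r < 1) :
    ContinuousOn (fun v => (1 - v⁻¹)⁻¹ * (p * (1 - X * v)⁻¹)) (Metric.sphere 0 r) := by
  intro v hv
  have hv : ‖v‖ = r := by simpa using hv
  have hv0 : v ≠ 0 := by rintro rfl; simp at hv; linarith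
  have hi : ContinuousAt (fun v : ℂ => v⁻¹) v := continuousAt_inv₀ hv0
  have c2 : ContinuousAt (fun v : ℂ => 1 - X * v) v := by fun_prop
  exact (((continuousAt_const.sub hi).inv₀ (Complex.slitPlane_ne_zero
    (one_sub_inv_mem_slitPlane (hv.symm ▸ hr)))).mul (continuousAt_const.mul (c2.inv₀
      (Complex.slitPlane_ne_zero
        (one_sub_mul_mem_slitPlane (hv.symm ▸ hX)))))).continuousWithinAt

theorem continuousOn_contour (hr : 1 < r) (hX : ‖X‖ * r < 1) (he : DiscSummable e)
    (hW : ∀ v : ℂ, ‖v‖ = r → ‖(1 - v⁻¹)⁻¹ * (p * (1 - X * v)⁻¹)‖ < 1) :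
    ContinuousOn (fun v => v⁻¹ * (1 - v⁻¹) ^ (-A) * (1 - X * v) ^ (-B) *
      powSum e ((1 - v⁻¹)⁻¹ * (p * (1 - X * v)⁻¹))) (Metric.sphere 0 r) :=
  (continuousOn_contour_factor hr hX).mul (he.differentiableOn.continuousOn.comp
    (continuousOn_contour_arg hr hX) fun v hv => by simpa using hW v (by simpa using hv))

/-- The `j`-th power of the argument merely raises `A` and `B` to `A + j` and `B + j`; as `j` is an
integer, no branch problem arises. -/
theorem hasSum_circleIntegral_powSum (hr : 1 < r) (hX : ‖X‖ * r < 1) (he : DiscSummable e)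
    (hW : ∀ v : ℂ, ‖v‖ = r → ‖(1 - v⁻¹)⁻¹ * (p * (1 - X * v)⁻¹)‖ < 1) :
    HasSum (fun j => e j * p ^ j * (2 * Real.pi * Complex.I *
        ∑' d, binCoeff (A + j) d * binCoeff (B + j) d * X ^ d))
      (∮ v in C(0, r), v⁻¹ * (1 - v⁻¹) ^ (-A) * (1 - X * v) ^ (-B) *
        powSum e ((1 - v⁻¹)⁻¹ * (p * (1 - X * v)⁻¹))) := by
  have hr0 : 0 < r := one_pos.trans hr
  set W : ℂ → ℂ := fun v => (1 - v⁻¹)⁻¹ * (p * (1 - X * v)⁻¹) with hWdef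
  set Φ : ℂ → ℂ := fun v => v⁻¹ * (1 - v⁻¹) ^ (-A) * (1 - X * v) ^ (-B) with hΦ
  have hΦc : ContinuousOn Φ (Metric.sphere 0 r) := continuousOn_contour_factor hr hX
  have hWc : ContinuousOn W (Metric.sphere 0 r) := continuousOn_contour_arg hr hX
  -- Compactness of the circle makes the bound `|W| < 1` uniform, which gives a summable majorant.
  obtain ⟨q, hq0, hq1, hq⟩ : ∃ q : ℝ, 0 < q ∧ q < 1 ∧ ∀ v ∈ Metric.sphere (0 : ℂ) r, ‖W v‖ ≤ q := by
    obtain ⟨v₀, hv₀, hmax⟩ := (isCompact_sphere (0 : ℂ) r).exists_isMaxOn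
      (NormedSpace.sphere_nonempty.2 hr0.le) hWc.norm
    obtain ⟨q, hq, hq1⟩ := exists_between (hW v₀ (by simpa using hv₀))
    exact ⟨q, (norm_nonneg _).trans_lt hq, hq1, fun v hv => (hmax hv).trans hq.le⟩
  obtain ⟨C, hC⟩ := (isCompact_sphere (0 : ℂ) r).exists_bound_of_continuousOn hΦc
  have h1 := hasSum_circleIntegral (r := r) (F := fun j v => Φ v * (e j * W v ^ j))
    (f := fun v => Φ v * powSum e (W v)) (b := fun j => C * (‖e j‖ * q ^ j)) hr0.le
    (fun j => hΦc.mul (continuousOn_const.mul (hWc.pow j))) (fun j v hv => ?_)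
    ((he q hq0 hq1).mul_left C) (fun v hv => (he.hasSum (hW v (by simpa using hv))).mul_left _)
  · refine h1.congr_fun fun j => ?_
    rw [← tsum_mul_left, (hasSum_circleIntegral_cpow (A + j) (B + j) hr hX).tsum_eq,
      ← circleIntegral.integral_const_mul]
    refine circleIntegral.integral_congr hr0.le fun v hv => ?_
    have hv : ‖v‖ = r := by simpa using hv
    have n1 := Complex.slitPlane_ne_zero (one_sub_inv_mem_slitPlane (hv.symm ▸ hr))
    have n2 : 1 - X * v ≠ 0 :=
      Complex.slitPlane_ne_zero (one_sub_mul_mem_slitPlane (hv.symm ▸ hX))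
    simp only [hΦ, hWdef]
    rw [← cpow_neg_mul_inv_pow n1, ← cpow_neg_mul_inv_pow n2, mul_pow, mul_pow]
    ring
  · rw [norm_mul (Φ v), norm_mul (e j), norm_pow]
    have hC0 : 0 ≤ C := (norm_nonneg _).trans (hC v hv)
    gcongr
    · exact hC v hv
    · exact hq v hv

end Contour

/-! ### Bounds for the coefficients -/

theorem norm_binCoeff_le {a : ℂ} {p : ℕ} (ha : ‖a‖ ≤ p + 1) (d : ℕ) :
    ‖binCoeff a d‖ ≤ ((p + d).choose d : ℕ) := by
  induction d with
  | zero => simp [binCoeff, poch]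
  | succ d ih =>
    have e : binCoeff a (d + 1) = binCoeff a d * ((a + d) / (d + 1)) := by
      have : (d.factorial : ℂ) ≠ 0 := by simp [Nat.factorial_ne_zero]
      have : (d : ℂ) + 1 ≠ 0 := Nat.cast_add_one_ne_zero d
      rw [binCoeff, binCoeff, poch_succ, Nat.factorial_succ]
      push_cast
      field_simp
    have h1 : ‖a + d‖ ≤ p + d + 1 := by
      refine (norm_add_le _ _).trans ?_
      rw [Complex.norm_natCast]; linarith
    have h2 : ((p + d).choose d : ℝ) * (p + d + 1) = ((p + (d + 1)).choose (d + 1) : ℕ) * (d + 1) := by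
      have := Nat.add_one_mul_choose_eq (p + d) d
      rw [mul_comm]
      exact_mod_cast this
    have h3 : ‖(d : ℂ) + 1‖ = d + 1 := by
      rw [← Nat.cast_add_one, Complex.norm_natCast]; simp
    rw [e, norm_mul, norm_div, h3, ← mul_div_assoc, div_le_iff₀ (by positivity), ← h2]
    gcongr

/-- Raising the upper index by one costs at most a linear factor, so a fixed shift costs a
polynomial one. -/
theorem choose_add_le (p n d : ℕ) (hd : d ≤ n) : (p + n).choose d ≤ (p + n) ^ p * n.choose d := by
  induction p with
  | zero => simp
  | succ p ih =>
    have h1 : (p + n + 1).choose d ≤ (p + n + 1) * (p + n).choose d := by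
      rw [mul_comm, Nat.choose_mul_succ_eq]
      exact Nat.le_mul_of_pos_right _ (by omega)
    rw [show p + 1 + n = p + n + 1 by ring]
    calc _ ≤ (p + n + 1) * ((p + n) ^ p * n.choose d) := h1.trans (Nat.mul_le_mul_left _ ih)
      _ ≤ (p + n + 1) * ((p + n + 1) ^ p * n.choose d) := Nat.mul_le_mul_left _
          (Nat.mul_le_mul_right _ (Nat.pow_le_pow_left (Nat.le_succ _) _))
      _ = _ := by ring

/-- The left side is one term in the expansion of `(t + (1 - t)) ^ (j + d) = 1`. -/
theorem choose_mul_pow_mul_pow_le_one {t : ℝ} (ht0 : 0 ≤ t) (ht1 : t ≤ 1) (j d : ℕ) :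
    ((j + d).choose d : ℝ) * (t ^ j * (1 - t) ^ d) ≤ 1 := by
  have h1 : 0 ≤ 1 - t := by linarith
  have h2 := add_pow t (1 - t) (j + d)
  rw [add_sub_cancel, one_pow] at h2
  have h3 := Finset.single_le_sum (s := Finset.range (j + d + 1))
    (f := fun m => t ^ m * (1 - t) ^ (j + d - m) * ((j + d).choose m : ℝ))
    (fun m _ => by positivity) (Finset.mem_range.2 (show j < j + d + 1 by omega))
  simp only [Nat.add_sub_cancel_left] at h3
  rw [Nat.choose_symm_add, ← h2] at h3
  linarith

theorem exists_natCast_add_pow_mul_pow_le (P K : ℕ) {s : ℝ} (hs0 : 0 < s) (hs1 : s < 1) :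
    ∃ C : ℝ, 0 ≤ C ∧ ∀ n : ℕ, ((P + n : ℕ) : ℝ) ^ K * s ^ n ≤ C := by
  have ht := tendsto_pow_const_mul_const_pow_of_abs_lt_one K
    (show |s| < 1 by rwa [abs_of_pos hs0])
  obtain ⟨C, hC⟩ := ht.bddAbove_range
  have hC' : ∀ n : ℕ, (n : ℝ) ^ K * s ^ n ≤ C := fun n => hC ⟨n, rfl⟩
  refine ⟨C / s ^ P, div_nonneg ?_ (by positivity), fun n => ?_⟩
  · exact (by positivity : (0 : ℝ) ≤ ((0 : ℕ) : ℝ) ^ K * s ^ 0).trans (hC' 0)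
  · rw [le_div_iff₀ (by positivity)]
    have := hC' (P + n)
    rw [pow_add] at this
    linarith

variable (ρ h : ℝ)

theorem poch_succ' (a : ℂ) (n : ℕ) : poch a (n + 1) = a * poch (a + 1) n := by
  induction n generalizing a with
  | zero => simp [poch]
  | succ n ih => rw [poch_succ, ih, poch_succ]; push_cast; ring

theorem poch_delta_mul_poch_delta (m j d : ℕ) :
    poch (deltaMinus ρ h m + j) d * poch (deltaPlus ρ h m + j) d =
      (∏ l ∈ Finset.range d, stepRatio ρ h (2 * m + j + l)) *
        (poch (2 * m + j + 1) d * poch (2 * m + j + 3 / 2) d) := by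
  induction d with
  | zero => simp [poch]
  | succ d ih =>
    have h1 := stepRatio_mul ρ h (2 * m + j + d)
    rw [poch_succ, poch_succ, Finset.prod_range_succ, poch_succ, poch_succ]
    have e : (deltaMinus ρ h m + j + d) * (deltaPlus ρ h m + j + d) =
        stepRatio ρ h (2 * m + j + d) * ((2 * m + j + 1 + d) * (2 * m + j + 3 / 2 + d)) := by
      push_cast at h1
      rw [show (2 * (m : ℂ) + j + 1 + d) * (2 * m + j + 3 / 2 + d) =
        (2 * m + j + d + 1) * (2 * m + j + d + 3 / 2) by ring, h1, deltaMinus, deltaPlus]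
      ring
    calc _ = (poch (deltaMinus ρ h m + j) d * poch (deltaPlus ρ h m + j) d) *
          ((deltaMinus ρ h m + j + d) * (deltaPlus ρ h m + j + d)) := by ring
      _ = _ := by rw [ih, e]; ring

/-- The coefficient of `X ^ d` in the contour integral of the `j`-th power. -/
noncomputable def contourCoeff (m : ℕ) (i : ℕ × ℕ) : ℂ :=
  binCoeff (deltaMinus ρ h m + i.1) i.2 * binCoeff (deltaPlus ρ h m + i.1) i.2

theorem exists_norm_contourCoeff_le (m : ℕ) : ∃ (C : ℝ) (P K : ℕ), 0 ≤ C ∧ ∀ i : ℕ × ℕ,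
    ‖contourCoeff ρ h m i‖ ≤
      C * ((P + (i.1 + i.2) : ℕ) : ℝ) ^ K * ((i.1 + i.2).choose i.2 : ℝ) ^ 2 := by
  -- The choice `α = 0` is arbitrary: paths without double steps do not see the weight.
  obtain ⟨M, hM0, hM⟩ := exists_norm_lameCoeff_le ρ 0 h
  refine ⟨M, 2 * m + 1, (2 * m + 1) * 2, hM0, fun ⟨j, d⟩ => ?_⟩
  have hf : ‖∏ l ∈ Finset.range d, stepRatio ρ h (2 * m + j + l)‖ ≤ M := by
    simpa [lameCoeff, pathSum] using hM 0 (2 * m + j) d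
  have e : contourCoeff ρ h m (j, d) = (∏ l ∈ Finset.range d, stepRatio ρ h (2 * m + j + l)) *
      (binCoeff (2 * m + j + 1) d * binCoeff (2 * m + j + 3 / 2) d) := by
    simp only [contourCoeff, binCoeff]
    rw [div_mul_div_comm, poch_delta_mul_poch_delta]
    ring
  have hb : ∀ x : ℝ, 0 ≤ x → x ≤ 2 * m + j + 2 → ‖binCoeff (x : ℂ) d‖ ≤
      ((2 * m + 1 + (j + d) : ℕ) : ℝ) ^ (2 * m + 1) * ((j + d).choose d : ℝ) := by
    intro x hx hx'
    have h1 := norm_binCoeff_le (a := x) (p := 2 * m + 1 + j) (by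
      rw [Complex.norm_real, Real.norm_of_nonneg hx]; push_cast; linarith) d
    refine h1.trans ?_
    rw [show 2 * m + 1 + j + d = 2 * m + 1 + (j + d) by ring]
    exact_mod_cast choose_add_le (2 * m + 1) (j + d) d (by omega)
  have hb1 := hb (2 * m + j + 1) (by positivity) (by linarith)
  have hb2 := hb (2 * m + j + 3 / 2) (by positivity) (by linarith)
  push_cast at hb1 hb2
  rw [e, norm_mul, norm_mul]
  push_cast
  calc _ ≤ M * ((((2 * m + 1 + (j + d)) : ℝ) ^ (2 * m + 1) * ((j + d).choose d : ℝ)) *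
        (((2 * m + 1 + (j + d)) : ℝ) ^ (2 * m + 1) * ((j + d).choose d : ℝ))) := by gcongr
    _ = _ := by ring

/-- `contourCoeff` grows like the square of a binomial coefficient, up to a polynomial. The
monomials in `t` and in `u` absorb one binomial each, and enlarging `‖w‖` to some `q < 1` absorbs
the polynomial. -/
theorem exists_bound_contour_terms (m : ℕ) {e : ℕ → ℂ} (he : DiscSummable e) {w : ℂ} (hw : w ≠ 0)
    (hw1 : ‖w‖ < 1) : ∃ b : ℕ × ℕ → ℝ, Summable b ∧ ∀ (i : ℕ × ℕ) (t u : ℝ),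
      t ∈ Set.Icc (0 : ℝ) 1 → u ∈ Set.Icc (0 : ℝ) 1 →
      ‖e i.1 * contourCoeff ρ h m i * w ^ (i.1 + i.2)‖ *
        (t ^ i.1 * (1 - t) ^ i.2) * (u ^ i.1 * (1 - u) ^ i.2) ≤ b i := by
  obtain ⟨M, P, K, hM0, hM⟩ := exists_norm_contourCoeff_le ρ h m
  obtain ⟨q, hq, hq1⟩ := exists_between hw1
  have hw0 : 0 < ‖w‖ := norm_pos_iff.2 hw
  have hq0 : 0 < q := hw0.trans hq
  obtain ⟨C, hC0, hC⟩ := exists_natCast_add_pow_mul_pow_le P K (s := ‖w‖ / q) (by positivity)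
    ((div_lt_one hq0).2 hq)
  have hs := ((he q hq0 hq1).mul_of_nonneg (summable_geometric_of_lt_one hq0.le hq1)
    (fun _ => by positivity) (fun _ => by positivity)).mul_left (M * C)
  refine ⟨_, hs, fun ⟨j, d⟩ t u ht hu => ?_⟩
  have hC' : ((P + (j + d) : ℕ) : ℝ) ^ K * ‖w‖ ^ (j + d) ≤ C * q ^ (j + d) := by
    have := hC (j + d)
    rwa [div_pow, ← mul_div_assoc, div_le_iff₀ (by positivity)] at this
  have h1 := choose_mul_pow_mul_pow_le_one ht.1 ht.2 j d
  have h2 := choose_mul_pow_mul_pow_le_one hu.1 hu.2 j d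
  have ht' : 0 ≤ 1 - t := by linarith [ht.2]
  have hu' : 0 ≤ 1 - u := by linarith [hu.2]
  have ht0 := ht.1
  have hu0 := hu.1
  dsimp only
  rw [norm_mul, norm_mul, norm_pow]
  calc _ ≤ ‖e j‖ * (M * ((P + (j + d) : ℕ) : ℝ) ^ K * ((j + d).choose d : ℝ) ^ 2) *
        ‖w‖ ^ (j + d) * (t ^ j * (1 - t) ^ d) * (u ^ j * (1 - u) ^ d) := by
        gcongr; exact hM (j, d)
    _ = ‖e j‖ * M * (((P + (j + d) : ℕ) : ℝ) ^ K * ‖w‖ ^ (j + d)) *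
        (((j + d).choose d : ℝ) * (t ^ j * (1 - t) ^ d)) *
        (((j + d).choose d : ℝ) * (u ^ j * (1 - u) ^ d)) := by ring
    _ ≤ ‖e j‖ * M * (C * q ^ (j + d)) * 1 * 1 := by gcongr
    _ = _ := by rw [pow_add]; ring

end Bounds

section Integrals

/-! ### The definite integrals -/

theorem hasSum_integral_zero_one {ι : Type*} [Countable ι] {F : ι → ℝ → ℂ} {b : ι → ℝ}
    (hF : ∀ i, Continuous (F i)) (hb : ∀ i, ∀ u ∈ Set.Icc (0 : ℝ) 1, ‖F i u‖ ≤ b i)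
    (hs : Summable b) :
    IntervalIntegrable (fun u => ∑' i, F i u) MeasureTheory.volume 0 1 ∧
      HasSum (fun i => ∫ u in (0 : ℝ)..1, F i u) (∫ u in (0 : ℝ)..1, ∑' i, F i u) := by
  refine ⟨(continuousOn_tsum (fun i => (hF i).continuousOn) hs hb).intervalIntegrable_of_Icc
    zero_le_one, ?_⟩
  have hmem : ∀ u ∈ Set.uIoc (0 : ℝ) 1, u ∈ Set.Icc (0 : ℝ) 1 := fun u hu => by
    rw [Set.uIoc_of_le zero_le_one] at hu
    exact Set.Ioc_subset_Icc_self hu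
  exact intervalIntegral.hasSum_integral_of_dominated_convergence (fun i _ => b i)
    (fun i => (hF i).aestronglyMeasurable) (fun i => .of_forall fun u hu => hb i u (hmem u hu))
    (.of_forall fun _ _ => hs) intervalIntegrable_const
    (.of_forall fun u hu => (Summable.of_norm_bounded hs fun i => hb i u (hmem u hu)).hasSum)

/-- The value of the Beta integral `∫₀¹ u ^ (s + j) (1 - u) ^ d du`. -/
noncomputable def betaCoeff (s : ℝ) (i : ℕ × ℕ) : ℂ :=
  i.2.factorial / poch (s + 1 + i.1) (i.2 + 1)

theorem poch_eq_prod (a : ℂ) (n : ℕ) : poch a n = ∏ l ∈ Finset.range n, (a + l) := by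
  induction n with
  | zero => simp [poch]
  | succ n ih => rw [poch_succ, Finset.prod_range_succ, ih]

theorem integral_rpow_mul_monomial {s : ℝ} (hs : 0 ≤ s) (i : ℕ × ℕ) :
    ∫ u in (0 : ℝ)..1, ((u ^ s : ℝ) : ℂ) * ((u ^ i.1 * (1 - u) ^ i.2 : ℝ) : ℂ) =
      betaCoeff s i := by
  have h1 := Complex.betaIntegral_eval_nat_add_one_right (u := s + 1 + i.1) (by
    simp; positivity) i.2
  rw [betaCoeff, poch_eq_prod, ← h1, Complex.betaIntegral]
  refine intervalIntegral.integral_congr_Ioo_of_le zero_le_one fun u hu => ?_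
  have hu0 : (u : ℂ) ≠ 0 := by exact_mod_cast hu.1.ne'
  rw [add_sub_cancel_right, Complex.cpow_natCast, show (s : ℂ) + 1 + i.1 - 1 = s + i.1 by ring,
    Complex.cpow_add _ _ hu0, Complex.cpow_natCast, Complex.ofReal_cpow hu.1.le]
  push_cast
  ring

/-- The last conclusion passes the majorant `b` on to the integrated terms, so that the lemma serves
first for `u` and then for `t`. -/
theorem hasSum_integral_rpow_mul {s : ℝ} (hs : 0 ≤ s) {T : ℕ × ℕ → ℂ} {b : ℕ × ℕ → ℝ}
    (hb : ∀ i, ∀ u ∈ Set.Icc (0 : ℝ) 1, ‖T i‖ * (u ^ i.1 * (1 - u) ^ i.2) ≤ b i)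
    (hsum : Summable b) :
    IntervalIntegrable (fun u : ℝ => ((u ^ s : ℝ) : ℂ) *
        ∑' i, T i * ((u ^ i.1 * (1 - u) ^ i.2 : ℝ) : ℂ)) MeasureTheory.volume 0 1 ∧
      HasSum (fun i => T i * betaCoeff s i) (∫ u in (0 : ℝ)..1, ((u ^ s : ℝ) : ℂ) *
        ∑' i, T i * ((u ^ i.1 * (1 - u) ^ i.2 : ℝ) : ℂ)) ∧
      ∀ i, ‖T i * betaCoeff s i‖ ≤ b i := by
  have hbound : ∀ i, ∀ u ∈ Set.Icc (0 : ℝ) 1,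
      ‖((u ^ s : ℝ) : ℂ) * (T i * ((u ^ i.1 * (1 - u) ^ i.2 : ℝ) : ℂ))‖ ≤ b i := by
    intro i u hu
    have h1 : 0 ≤ 1 - u := by linarith [hu.2]
    have h0 := hu.1
    rw [norm_mul, norm_mul, Complex.norm_real, Complex.norm_real,
      Real.norm_of_nonneg (Real.rpow_nonneg h0 s), Real.norm_of_nonneg (by positivity)]
    exact (mul_le_of_le_one_left (by positivity) (Real.rpow_le_one h0 hu.2 hs)).trans (hb i u hu)
  have hval : ∀ i, ∫ u in (0 : ℝ)..1, ((u ^ s : ℝ) : ℂ) *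
      (T i * ((u ^ i.1 * (1 - u) ^ i.2 : ℝ) : ℂ)) = T i * betaCoeff s i := by
    intro i
    rw [← integral_rpow_mul_monomial hs, ← intervalIntegral.integral_const_mul]
    congr 1
    ext u
    ring
  have hcont : ∀ i, Continuous fun u : ℝ =>
      ((u ^ s : ℝ) : ℂ) * (T i * ((u ^ i.1 * (1 - u) ^ i.2 : ℝ) : ℂ)) := fun i => by
    have := Real.continuous_rpow_const hs
    fun_prop
  have h1 := hasSum_integral_zero_one hcont hbound hsum
  simp only [tsum_mul_left, hval] at h1
  refine ⟨h1.1, h1.2, fun i => ?_⟩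
  rw [← hval]
  refine (intervalIntegral.norm_integral_le_of_norm_le_const (C := b i) fun u hu => ?_).trans_eq
    (by simp)
  rw [Set.uIoc_of_le zero_le_one] at hu
  exact hbound i u (Set.Ioc_subset_Icc_self hu)

/-! ### One step of the integral recursion -/

section Step

variable (ρ α h : ℝ) (m : ℕ)

/-- The coefficients of the power series to which the `m`-th differential operator maps the power
series with coefficients `c`. -/
noncomputable def eulerCoeff (c : ℕ → ℂ) (j : ℕ) : ℂ :=
  ((j : ℂ) + (2 * m - 1 + α / 2)) * (((j : ℂ) + (2 * m - 3 / 2 - α / 2)) * c j)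

theorem discSummable_eulerCoeff {c : ℕ → ℂ} (hc : DiscSummable c) :
    DiscSummable (eulerCoeff α m c) :=
  (hc.natCast_add_mul _).natCast_add_mul _

/-- The coefficient of `(t u) ^ j ((1 - t) (1 - u)) ^ d`, `i = (j, d)`, in the double series for the
contour integral. -/
noncomputable def stepTerm (c : ℕ → ℂ) (w : ℂ) (i : ℕ × ℕ) : ℂ :=
  eulerCoeff α m c i.1 * contourCoeff ρ h m i * w ^ (i.1 + i.2)

theorem wNext_eq {w v : ℂ} (hv : v ≠ 0) (t u : ℝ) : wNext w t u v =
    (1 - v⁻¹)⁻¹ * (w * t * u * (1 - w * (1 - t) * (1 - u) * v)⁻¹) := by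
  rw [wNext, show 1 - v⁻¹ = (v - 1) / v by field_simp, inv_div, div_eq_mul_inv (w * t * u)]
  ring_nf

variable {c : ℕ → ℂ} {f : ℂ → ℂ} {w : ℂ} {t u r : ℝ}

theorem contourIntegrand_eqOn (hc : DiscSummable c)
    (hf : ∀ w, w ≠ 0 → ‖w‖ < 1 → f w = powSum c w) (hw : w ≠ 0) (ht : t ∈ Set.Ioo (0 : ℝ) 1)
    (hu : u ∈ Set.Ioo (0 : ℝ) 1) (hr : 1 < r) (hX : ‖w‖ * (1 - t) * (1 - u) * r < 1)
    (hW : ∀ v : ℂ, ‖v‖ = r → ‖wNext w t u v‖ < 1) :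
    Set.EqOn (contourIntegrand ρ α h m f w t u) (fun v => v⁻¹ * (1 - v⁻¹) ^ (-deltaMinus ρ h m) *
      (1 - w * (1 - t) * (1 - u) * v) ^ (-deltaPlus ρ h m) * powSum (eulerCoeff α m c)
        ((1 - v⁻¹)⁻¹ * (w * t * u * (1 - w * (1 - t) * (1 - u) * v)⁻¹))) (Metric.sphere 0 r) := by
  intro v hv
  have hv : ‖v‖ = r := by simpa using hv
  have hv0 : v ≠ 0 := by rintro rfl; simp at hv; linarith
  have hX' : ‖w * (1 - t) * (1 - u)‖ * ‖v‖ < 1 := by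
    have e1 : ∀ t : ℝ, t ∈ Set.Ioo (0 : ℝ) 1 → ‖(1 - t : ℂ)‖ = 1 - t := fun t ht => by
      rw [show (1 - t : ℂ) = ((1 - t : ℝ) : ℂ) by push_cast; rfl, Complex.norm_real,
        Real.norm_of_nonneg (by linarith [ht.2])]
    rwa [norm_mul, norm_mul, e1 t ht, e1 u hu, hv]
  have n1 := Complex.slitPlane_ne_zero (one_sub_inv_mem_slitPlane (hv.symm ▸ hr))
  have n2 := Complex.slitPlane_ne_zero (one_sub_mul_mem_slitPlane hX')
  have ht0 : (t : ℂ) ≠ 0 := by exact_mod_cast ht.1.ne'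
  have hu0 : (u : ℂ) ≠ 0 := by exact_mod_cast hu.1.ne'
  have hn0 : wNext w t u v ≠ 0 := by
    rw [wNext_eq hv0]
    exact mul_ne_zero (inv_ne_zero n1) (mul_ne_zero (mul_ne_zero (mul_ne_zero hw ht0) hu0)
      (inv_ne_zero n2))
  -- The exponents of `D_m` fit: `(α + 1/2) + (2m - 3/2 - α/2) = 2m - 1 + α/2`.
  rw [contourIntegrand, eulerOp_eq_powSum (by ring) hc hf hn0 (hW v hv), wNext_eq hv0, one_div,
    sub_div, div_self hv0, one_div]
  rfl

theorem circleIntegral_contourIntegrand (hc : DiscSummable c)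
    (hf : ∀ w, w ≠ 0 → ‖w‖ < 1 → f w = powSum c w) (hw : w ≠ 0) (hw1 : ‖w‖ < 1)
    (ht : t ∈ Set.Ioo (0 : ℝ) 1)
    (hu : u ∈ Set.Ioo (0 : ℝ) 1) (hr : 1 < r) (hX : ‖w‖ * (1 - t) * (1 - u) * r < 1)
    (hW : ∀ v : ℂ, ‖v‖ = r → ‖wNext w t u v‖ < 1) :
    CircleIntegrable (contourIntegrand ρ α h m f w t u) 0 r ∧
      (2 * Real.pi * Complex.I)⁻¹ * (∮ v in C(0, r), contourIntegrand ρ α h m f w t u v) =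
        ∑' i, stepTerm ρ α h m c w i * ((t ^ i.1 * (1 - t) ^ i.2 : ℝ) : ℂ) *
          ((u ^ i.1 * (1 - u) ^ i.2 : ℝ) : ℂ) := by
  have hr0 : 0 ≤ r := by linarith
  have heq := contourIntegrand_eqOn ρ α h m hc hf hw ht hu hr hX hW
  have he := discSummable_eulerCoeff α m hc
  have hX' : ‖w * (1 - t) * (1 - u)‖ * r < 1 := by
    have e1 : ∀ t : ℝ, t ∈ Set.Ioo (0 : ℝ) 1 → ‖(1 - t : ℂ)‖ = 1 - t := fun t ht => by
      rw [show (1 - t : ℂ) = ((1 - t : ℝ) : ℂ) by push_cast; rfl, Complex.norm_real,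
        Real.norm_of_nonneg (by linarith [ht.2])]
    rwa [norm_mul, norm_mul, e1 t ht, e1 u hu]
  have hW' : ∀ v : ℂ, ‖v‖ = r →
      ‖(1 - v⁻¹)⁻¹ * (w * t * u * (1 - w * (1 - t) * (1 - u) * v)⁻¹)‖ < 1 := fun v hv => by
    rw [← wNext_eq (by rintro rfl; simp at hv; linarith)]
    exact hW v hv
  refine ⟨((continuousOn_contour hr hX' he hW').congr heq).circleIntegrable hr0, ?_⟩
  obtain ⟨b, hb, hbb⟩ := exists_bound_contour_terms ρ h m he hw hw1
  have hs : Summable fun i : ℕ × ℕ => stepTerm ρ α h m c w i *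
      ((t ^ i.1 * (1 - t) ^ i.2 : ℝ) : ℂ) * ((u ^ i.1 * (1 - u) ^ i.2 : ℝ) : ℂ) := by
    refine .of_norm_bounded hb fun i => ?_
    have h1 : 0 ≤ 1 - t := by linarith [ht.2]
    have h2 : 0 ≤ 1 - u := by linarith [hu.2]
    have h3 := ht.1.le
    have h4 := hu.1.le
    rw [norm_mul, norm_mul, Complex.norm_real, Complex.norm_real,
      Real.norm_of_nonneg (by positivity), Real.norm_of_nonneg (by positivity)]
    exact hbb i t u (Set.Ioo_subset_Icc_self ht) (Set.Ioo_subset_Icc_self hu)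
  have h1 := hasSum_circleIntegral_powSum (A := deltaMinus ρ h m) (B := deltaPlus ρ h m) hr hX' he hW'
  rw [circleIntegral.integral_congr hr0 heq, ← h1.tsum_eq, ← tsum_mul_left, hs.tsum_prod]
  refine tsum_congr fun j => ?_
  rw [← tsum_mul_left, ← tsum_mul_left, ← tsum_mul_left]
  refine tsum_congr fun d => ?_
  have hpi := Complex.two_pi_I_ne_zero
  simp only [stepTerm, contourCoeff]
  push_cast
  rw [mul_left_comm _ (_ * _ ^ j), inv_mul_cancel_left₀ hpi, pow_add,
    mul_pow (w * (1 - (t : ℂ))) (1 - (u : ℂ)) d, mul_pow w (1 - (t : ℂ)) d]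
  ring

variable (r : ℝ → ℝ → ℝ)

theorem integral_step (hm : 1 ≤ m) (hc : DiscSummable c)
    (hf : ∀ w, w ≠ 0 → ‖w‖ < 1 → f w = powSum c w) (hw : w ≠ 0) (hw1 : ‖w‖ < 1)
    (hr : ∀ t ∈ Set.Ioo (0 : ℝ) 1, ∀ u ∈ Set.Ioo (0 : ℝ) 1, 1 < r t u ∧
      ‖w‖ * (1 - t) * (1 - u) * r t u < 1 ∧ ∀ v : ℂ, ‖v‖ = r t u → ‖wNext w t u v‖ < 1) :
    (∀ t ∈ Set.Ioo (0 : ℝ) 1, ∀ u ∈ Set.Ioo (0 : ℝ) 1,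
      CircleIntegrable (contourIntegrand ρ α h m f w t u) 0 (r t u)) ∧
    (∀ t ∈ Set.Ioo (0 : ℝ) 1, IntervalIntegrable (fun u => uIntegrand ρ α h m f (r t u) w t u)
      MeasureTheory.volume 0 1) ∧
    IntervalIntegrable (fun t => tIntegrand ρ α h m f (r t) w t) MeasureTheory.volume 0 1 ∧
    HasSum (fun i => stepTerm ρ α h m c w i * betaCoeff (2 * m - 1) i *
      betaCoeff (2 * m - 1 / 2) i) (∫ t in (0 : ℝ)..1, tIntegrand ρ α h m f (r t) w t) := by
  have hm' : (1 : ℝ) ≤ m := by exact_mod_cast hm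
  obtain ⟨b, hb, hbb⟩ := exists_bound_contour_terms ρ h m (discSummable_eulerCoeff α m hc) hw hw1
  have hcirc := fun t ht u hu => circleIntegral_contourIntegrand ρ α h m hc hf hw hw1
    (t := t) ht (u := u) hu (hr t ht u hu).1 (hr t ht u hu).2.1 (hr t ht u hu).2.2
  have hu := fun (t : ℝ) (ht : t ∈ Set.Icc (0 : ℝ) 1) => hasSum_integral_rpow_mul
    (s := 2 * m - 1) (by linarith)
    (T := fun i => stepTerm ρ α h m c w i * ((t ^ i.1 * (1 - t) ^ i.2 : ℝ) : ℂ)) (b := b)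
    (fun i u hu => by
      have h1 : 0 ≤ 1 - t := by linarith [ht.2]
      have h3 := ht.1
      rw [norm_mul, Complex.norm_real, Real.norm_of_nonneg (r := t ^ _ * _) (by positivity)]
      exact hbb i t u ht hu) hb
  -- Nothing is known about the radii at the end points, so integrands are compared on open
  -- intervals only.
  have hueq : ∀ t ∈ Set.Ioo (0 : ℝ) 1, Set.EqOn (fun u => uIntegrand ρ α h m f (r t u) w t u)
      (fun u : ℝ => ((u ^ (2 * (m : ℝ) - 1) : ℝ) : ℂ) * ∑' i, stepTerm ρ α h m c w i *
        ((t ^ i.1 * (1 - t) ^ i.2 : ℝ) : ℂ) * ((u ^ i.1 * (1 - u) ^ i.2 : ℝ) : ℂ))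
      (Set.Ioo 0 1) := fun t ht u hu => by
    simp only [uIntegrand]
    rw [(hcirc t ht u hu).2]
  have ht := hasSum_integral_rpow_mul (s := 2 * m - 1 / 2) (by linarith)
    (T := fun i => stepTerm ρ α h m c w i * betaCoeff (2 * m - 1) i) (b := b)
    (fun i t ht => by
      have h1 : 0 ≤ 1 - t := by linarith [ht.2]
      have h3 := ht.1
      refine le_trans (le_of_eq ?_) ((hu t ht).2.2 i)
      rw [norm_mul, norm_mul, norm_mul, Complex.norm_real,
        Real.norm_of_nonneg (r := t ^ _ * _) (by positivity)]
      ring) hb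
  have hteq : Set.EqOn (fun t => tIntegrand ρ α h m f (r t) w t)
      (fun t : ℝ => ((t ^ (2 * (m : ℝ) - 1 / 2) : ℝ) : ℂ) * ∑' i, stepTerm ρ α h m c w i *
        betaCoeff (2 * m - 1) i * ((t ^ i.1 * (1 - t) ^ i.2 : ℝ) : ℂ))
      (Set.Ioo 0 1) := fun t ht => by
    simp only [tIntegrand]
    rw [intervalIntegral.integral_congr_Ioo_of_le zero_le_one (hueq t ht),
      ← (hu t (Set.Ioo_subset_Icc_self ht)).2.1.tsum_eq]
    congr 1
    exact tsum_congr fun i => by ring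
  refine ⟨fun t ht u hu => (hcirc t ht u hu).1, fun t ht => ?_, ?_, ?_⟩
  · refine (hu t (Set.Ioo_subset_Icc_self ht)).1.congr_uIoo ?_
    rw [Set.uIoo_of_le zero_le_one]
    exact (hueq t ht).symm
  · refine ht.1.congr_uIoo ?_
    rw [Set.uIoo_of_le zero_le_one]
    exact hteq.symm
  · rw [intervalIntegral.integral_congr_Ioo_of_le zero_le_one hteq]
    exact ht.2.1

end Step

/-! ### The integral representation -/

variable (ρ α h : ℝ) (R : ℕ → ℂ → ℝ → ℝ → ℝ)

theorem discSummable_lameCoeff (n : ℕ) : DiscSummable (lameCoeff ρ α h n 0) := by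
  intro q hq0 hq1
  have := (summable_lameCoeff ρ α h (x := q)
    (by rwa [Complex.norm_real, Real.norm_of_nonneg hq0.le]) n 0).norm
  simpa [abs_of_pos hq0] using this

/-- With `m = n + 1`, the Beta integrals contribute `d! / ((2m + j)(2m + j + 1)_d)` and `d! / ((2m +
j + 1/2)(2m + j + 3/2)_d)`. The factorials cancel those of the contour integral, the Pochhammer
symbols complete the step ratios, and the two isolated factors are the denominator of the weight at
degree `2n + j`. -/
theorem stepTerm_mul_betaCoeff (n : ℕ) (w : ℂ) (i : ℕ × ℕ) :
    stepTerm ρ α h (n + 1) (lameCoeff ρ α h n 0) w i * betaCoeff (2 * (n + 1 : ℕ) - 1) i *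
      betaCoeff (2 * (n + 1 : ℕ) - 1 / 2) i =
    lameCoeff ρ α h n 0 i.1 * weight α 0 (0 + 2 * n + i.1) *
      (∏ l ∈ Finset.range i.2, stepRatio ρ h (0 + 2 * n + i.1 + 2 + l)) * w ^ (i.1 + i.2) := by
  obtain ⟨j, d⟩ := i
  have h1 := poch_delta_mul_poch_delta ρ h (n + 1) j d
  have hw := weight_mul α (0 + 2 * n + j)
  have hd : (d.factorial : ℂ) ≠ 0 := by simp [Nat.factorial_ne_zero]
  have hp1 : poch (2 * (n + 1 : ℕ) + j + 1) d ≠ 0 := by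
    simpa using poch_ne_zero (a := 2 * (n + 1 : ℕ) + j + 1) (by positivity) d
  have hp2 : poch (2 * (n + 1 : ℕ) + j + 3 / 2) d ≠ 0 := by
    simpa using poch_ne_zero (a := 2 * (n + 1 : ℕ) + j + 3 / 2) (by positivity) d
  have n1 : (2 * (n + 1 : ℕ) + j : ℂ) ≠ 0 := by
    exact_mod_cast (by positivity : 2 * (n + 1) + j ≠ 0)
  have n2 : (2 * (n + 1 : ℕ) + j + 1 / 2 : ℂ) ≠ 0 := by
    simpa using Complex.ofReal_ne_zero.2
      (by positivity : (2 * (n + 1 : ℕ) + j + 1 / 2 : ℝ) ≠ 0)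
  have e1 : betaCoeff (2 * (n + 1 : ℕ) - 1) (j, d) =
      d.factorial / ((2 * (n + 1 : ℕ) + j) * poch (2 * (n + 1 : ℕ) + j + 1) d) := by
    rw [betaCoeff, ← poch_succ']; congr 2; push_cast; ring
  have e2 : betaCoeff (2 * (n + 1 : ℕ) - 1 / 2) (j, d) =
      d.factorial / ((2 * (n + 1 : ℕ) + j + 1 / 2) * poch (2 * (n + 1 : ℕ) + j + 3 / 2) d) := by
    rw [betaCoeff, show (2 * (n + 1 : ℕ) + j + 3 / 2 : ℂ) = 2 * (n + 1 : ℕ) + j + 1 / 2 + 1 by ring,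
      ← poch_succ']
    congr 2; push_cast; ring
  have e3 : contourCoeff ρ h (n + 1) (j, d) =
      (∏ l ∈ Finset.range d, stepRatio ρ h (0 + 2 * n + j + 2 + l)) *
        (poch (2 * (n + 1 : ℕ) + j + 1) d * poch (2 * (n + 1 : ℕ) + j + 3 / 2) d) /
          (d.factorial * d.factorial) := by
    simp only [contourCoeff, binCoeff]
    rw [div_mul_div_comm, h1]
    congr 2
    exact Finset.prod_congr rfl fun l _ => by congr 1; ring
  have e4 : eulerCoeff α (n + 1) (lameCoeff ρ α h n 0) j = weight α 0 (0 + 2 * n + j) *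
      ((2 * (n + 1 : ℕ) + j + 1 / 2) * (2 * (n + 1 : ℕ) + j)) * lameCoeff ρ α h n 0 j := by
    rw [eulerCoeff, show (2 * (n + 1 : ℕ) + j + 1 / 2 : ℂ) = (0 + 2 * n + j : ℕ) + 5 / 2 by
      push_cast; ring, show (2 * (n + 1 : ℕ) + j : ℂ) = (0 + 2 * n + j : ℕ) + 2 by
      push_cast; ring, hw]
    push_cast
    ring
  rw [stepTerm, e1, e2]
  dsimp only
  rw [e3, e4]
  generalize poch (2 * (n + 1 : ℕ) + j + 1) d = p1 at hp1 ⊢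
  generalize poch (2 * (n + 1 : ℕ) + j + 3 / 2) d = p2 at hp2 ⊢
  generalize (2 * (n + 1 : ℕ) + j + 1 / 2 : ℂ) = x at n2 ⊢
  field_simp

theorem subIntegral_zero (w : ℂ) : subIntegral ρ α h R 0 w = powSum (lameCoeff ρ α h 0 0) w := by
  rw [subIntegral, ordinaryHypergeometric_eq_tsum, powSum]
  refine tsum_congr fun j => ?_
  have h1 := ratio_eq_prod ρ h 0 0 j
  rw [lameCoeff, pathSum]
  simp only [mul_zero, add_zero] at h1 ⊢
  rw [← h1, ratio, zero_add]
  have e : ∀ a : ℂ, pochQuot a 0 j = poch a j := fun a => by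
    simpa [poch] using pochQuot_eq_div a 0 j (Nat.zero_le _) (by simp [poch])
  have e0 : ∀ a : ℂ, poch a 0 = 1 := fun a => by simp [poch]
  have e1 : poch 1 j = j.factorial := by rw [poch, ascPochhammer_eval_one]
  rw [e, e, e0, e0, Nat.cast_zero, mul_zero, zero_add, zero_add, e1, smul_eq_mul]
  simp only [poch]
  field_simp

/-- Each further integration appends one double step followed by `d` unit steps; collecting terms
with `j + d` fixed gives the decomposition at the last double step. -/
theorem subIntegral_eq (hR : AdmissibleRadii R) (n : ℕ) (w : ℂ) (hw : w ≠ 0) (hw1 : ‖w‖ < 1) :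
    subIntegral ρ α h R n w = powSum (lameCoeff ρ α h n 0) w := by
  induction n generalizing w with
  | zero => exact subIntegral_zero ρ α h R w
  | succ n ih =>
    have h1 := (integral_step ρ α h (n + 1) (R (n + 1) w) (by omega)
      (discSummable_lameCoeff ρ α h n) ih hw hw1
      fun t ht u hu => hR (n + 1) w t u (by omega) hw hw1 ht hu).2.2.2
    rw [subIntegral, powSum]
    refine HasSum.unique (f := fun m => lameCoeff ρ α h (n + 1) 0 m * w ^ m) ?_
      (summable_lameCoeff ρ α h hw1 (n + 1) 0).hasSum
    refine ((Finset.HasAntidiagonal.sigmaAntidiagonalEquivProd (A := ℕ)).hasSum_iff.2 h1).sigma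
      fun m => ?_
    convert hasSum_fintype _ using 1
    rw [lameCoeff, pathSum_succ_eq_sum_antidiagonal, Finset.sum_mul, ← Finset.sum_coe_sort]
    refine Finset.sum_congr rfl fun p _ => ?_
    have hp := Finset.HasAntidiagonal.mem_antidiagonal.1 p.2
    simp only [Function.comp, Finset.HasAntidiagonal.sigmaAntidiagonalEquivProd_apply]
    rw [stepTerm_mul_betaCoeff, show w ^ (p.1.1 + p.1.2) = w ^ m by rw [hp]]

theorem integralsExist (hR : AdmissibleRadii R) : IntegralsExist ρ α h R := by
  refine fun m => ⟨?_, fun w hw hw1 => ?_⟩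
  · refine ((discSummable_lameCoeff ρ α h m).differentiableOn.mono Set.sdiff_subset).congr
      fun w hw => subIntegral_eq ρ α h R hR m w hw.2 (by simpa using hw.1)
  · obtain ⟨h1, h2, h3, -⟩ := integral_step ρ α h (m + 1) (R (m + 1) w) (by omega)
      (discSummable_lameCoeff ρ α h m) (subIntegral_eq ρ α h R hR m) hw hw1
      fun t ht u hu => hR (m + 1) w t u (by omega) hw hw1 ht hu
    exact ⟨h1, h2, h3⟩

end Integrals

end Lame

theorem mainTheorem8 (ρ α h : ℝ) (hρ0 : 0 < ρ) (hρ1 : ρ < 1)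
    (R : ℕ → ℂ → ℝ → ℝ → ℝ) (hR : Lame.AdmissibleRadii R) :
    Lame.IntegralsExist ρ α h R ∧
    (∀ x : ℂ, x ≠ 0 → ‖x‖ < 1 → Lame.NestedSummable ρ α h x ∧
      ∀ n : ℕ, Lame.subSeries ρ α h n x = Lame.subIntegral ρ α h R n x) ∧
    (∀ ξ : ℂ, ξ ≠ 0 → ‖Lame.eta ρ ξ‖ + ‖Lame.zvar ρ ξ‖ < 1 →
      (Summable fun n : ℕ => Lame.subSeries ρ α h n (Lame.eta ρ ξ) * Lame.zvar ρ ξ ^ n) ∧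
      (Summable fun n : ℕ =>
        Lame.subIntegral ρ α h R (n + 1) (Lame.eta ρ ξ) * Lame.zvar ρ ξ ^ (n + 1)) ∧
      Lame.LS ρ α h ξ = ξ ^ (1 / 2 : ℂ) *
        (ordinaryHypergeometric (Lame.deltaMinus ρ h 0) (Lame.deltaPlus ρ h 0) (3 / 2 : ℂ)
            (Lame.eta ρ ξ) +
          ∑' n : ℕ, Lame.subIntegral ρ α h R (n + 1) (Lame.eta ρ ξ)
            * Lame.zvar ρ ξ ^ (n + 1))) ∧
    DifferentiableOn ℂ (Lame.LS ρ α h)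
      {ξ : ℂ | ξ ∈ Complex.slitPlane ∧ ‖Lame.eta ρ ξ‖ + ‖Lame.zvar ρ ξ‖ < 1} ∧
    (∀ ξ : ℂ, ξ ∈ Complex.slitPlane → ‖Lame.eta ρ ξ‖ + ‖Lame.zvar ρ ξ‖ < 1 →
      Lame.LameEquationAt ρ α h (Lame.LS ρ α h) ξ) := by
  have heq : ∀ x : ℂ, x ≠ 0 → ‖x‖ < 1 → ∀ n : ℕ,
      Lame.subSeries ρ α h n x = Lame.subIntegral ρ α h R n x := fun x hx hx1 n => by
    rw [Lame.subSeries_eq ρ α h hx1, Lame.subIntegral_eq ρ α h R hR n x hx hx1, Lame.powSum]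
  refine ⟨Lame.integralsExist ρ α h R hR,
    fun x hx hx1 => ⟨Lame.nestedSummable ρ α h hx1, heq x hx hx1⟩, fun ξ hξ hξ1 => ?_,
    Lame.differentiableOn_LS ρ α h, fun ξ hξ hξ1 => Lame.lameEquationAt_LS ρ α h hρ0 hρ1 hξ hξ1⟩
  -- The integrals are identified with the series only on the punctured disc.
  have hη : Lame.eta ρ ξ ≠ 0 :=
    mul_ne_zero (by exact_mod_cast (by positivity : 1 + ρ ^ 2 ≠ 0)) hξ
  have hη1 : ‖Lame.eta ρ ξ‖ < 1 := by linarith [norm_nonneg (Lame.zvar ρ ξ)]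
  have hs := (Lame.hasSum_subSeries_mul_pow ρ α h hξ1).summable
  have hs' := (summable_nat_add_iff 1).2 hs
  simp only [heq _ hη hη1] at hs'
  refine ⟨hs, hs', ?_⟩
  rw [Lame.LS, hs.tsum_eq_zero_add]
  simp only [heq _ hη hη1, pow_zero, mul_one]
  rfl
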